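/- Work over the field $\mathbb{Q}(q)$ of rational functions in an indeterminate $q$. A linear $q$-difference equation is an equation $\sum_{i=0}^{d} a_i(q,q^n)\,J(n+i)=0$ with coefficients $a_i\in\mathbb{Q}(q,Q)$; it is nontrivial if not all $a_i$ are zero. A sequence $J:\mathbb{N}=\{0,1,2,\dots\}\to\mathbb{Q}(q)$ satisfies the equation if it holds for every $n\ge 0$ at which no coefficient $a_i(q,Q)$ has a pole at $Q=q^n$. The sequence is $q$-holonomic if it satisfies some nontrivial linear $q$-difference equation. For $x\in\mathbb{Q}(q)$ and $m\in\mathbb{Z}$ let $(x;q)_m=\prod_{i=0}^{m-1}(1-xq^i)$ if $m\ge 0$ and $(x;q)_m=\prod_{i=1}^{-m}(1-xq^{-i})^{-1}$ if $m<0$. A proper $q$-hypergeometric term is an expression $$c(n,k)=p(q^n,q^k)\,\xi^n\eta^k\,q^{e(n,k)}\,\frac{\prod_{r}(x_r q^{s_r(n,k)};q)_{m_r(n,k)}}{\prod_{t}(y_t q^{u_t(n,k)};q)_{v_t(n,k)}}$$ (finite products), where $p$ is a polynomial in two variables over $\mathbb{Q}(q)$, $\xi,\eta\in\mathbb{Q}(q)\setminus\{0\}$,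 $x_r,y_t\in\mathbb{Q}(q)$, $e$ is an integer-valued quadratic polynomial in $n,k$, and $s_r,m_r,u_t,v_t$ are linear forms $an+bk+c$ with $a,b,c\in\mathbb{Z}$, such that every factor is defined for all integers $0\le k\le n$, i.e. no factor $(x_r q^{s_r};q)_{m_r}$ and no factor $1/(y_t q^{u_t};q)_{v_t}$ involves a division by zero (for $v<0$ one reads $1/(y;q)_v=\prod_{i=1}^{-v}(1-yq^{-i})$, which may be $0$). **Theorem.** (1) Let $c(n,k)$, $0\le k\le n$, be a proper $q$-hypergeometric term, let $(\hat J(n))_{n\ge 0}$ be a $q$-holonomic sequence in $\mathbb{Q}(q)$, and let $$J(n)=\sum_{k=0}^{n}c(n,k)\,\hat J(k)\qquad(n\ge 0).$$ Then $(J(n))$ is $q$-holonomic. (2) A linear $q$-difference equation for $J$ can be constructed from one for $\hat J$ together with $c$: there is an algorithm (a partial recursive function) that takes as input a linear $q$-difference equation and an expression of the above form, both given by finite lists of integers, and that, whenever the equation is nontrivial and the expression is a proper $q$-hypergeometric term $c(n,k)$, terminates and returns a nontrivial linear $q$-difference equation that is satisfied by $J(n)=\sum_{k=0}^{n}c(n,k)\hat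 J(k)$ for every sequence $\hat J$ satisfying the input equation. -/

import Mathlib

namespace QHolonomic

/-- The field `ℚ(q)`. -/
abbrev Kq : Type := RatFunc ℚ

/-- The indeterminate `q` of `ℚ(q)`. -/
noncomputable def q : Kq := RatFunc.X

/-- The field `ℚ(q, Q)`, where `Q` stands for `q ^ n`. -/
abbrev KqQ : Type := RatFunc Kq

/-! ### Linear `q`-difference equations and `q`-holonomic sequences -/

/-- `a(q, Q)` has no pole at `Q = q ^ n`. -/
def DefinedAt (a : KqQ) (n : ℕ) : Prop :=
  a.denom.eval (q ^ n) ≠ 0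

/-- The value `a(q, q ^ n)`. -/
noncomputable def valueAt (a : KqQ) (n : ℕ) : Kq :=
  a.eval (RingHom.id Kq) (q ^ n)

/-- The list `L = [a₀, …, a_d]` represents the linear `q`-difference equation
`∑ i, a_i(q, q ^ n) J(n + i) = 0`. The sequence `J` satisfies it if it holds at every `n ≥ 0` at
which all coefficients are defined (this excludes only finitely many `n`). -/
def Satisfies (J : ℕ → Kq) (L : List KqQ) : Prop :=
  ∀ n : ℕ, (∀ a ∈ L, DefinedAt a n) →
    ∑ i : Fin L.length, valueAt (L.get i) n * J (n + (i : ℕ)) = 0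

/-- The equation is not the trivial equation `0 = 0`. -/
def IsNontrivial (L : List KqQ) : Prop :=
  ∃ a ∈ L, a ≠ 0

/-- `J` satisfies a nontrivial linear `q`-difference equation with coefficients in
`ℚ(q, q ^ n)`. -/
def IsQHolonomic (J : ℕ → Kq) : Prop :=
  ∃ L : List KqQ, IsNontrivial L ∧ Satisfies J L

/-! ### Finite descriptions of rational functions and of equations -/

/-- `coeffEval x [c₀, c₁, …, c_d] = c₀ + c₁ x + ⋯ + c_d x ^ d`. -/
def coeffEval {R : Type*} [Semiring R] (x : R) (l : List R) : R :=
  l.foldr (fun c s => c + x * s) 0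

/-- The element of `ℤ[q]` with the given list of coefficients, constant coefficient first. -/
noncomputable def intPoly (l : List ℤ) : Kq :=
  coeffEval q (l.map fun c => (c : Kq))

/-- A numerator and a denominator in `ℤ[q]`, describing an element of `ℚ(q)`. -/
abbrev RatCode : Type := List ℤ × List ℤ

noncomputable def RatCode.val (r : RatCode) : Kq :=
  intPoly r.1 / intPoly r.2

/-- The element of `ℤ[q][Q]` with the given list of coefficients, constant coefficient first. -/
noncomputable def intPoly₂ (l : List (List ℤ)) : KqQ :=
  coeffEval RatFunc.X (l.map fun c => RatFunc.C (intPoly c))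

/-- The list of the coefficients of a linear `q`-difference equation, each given by a numerator
and a denominator in `ℤ[q][Q]`. -/
abbrev EqCode : Type := List (List (List ℤ) × List (List ℤ))

noncomputable def EqCode.toEq (e : EqCode) : List KqQ :=
  e.map fun c => intPoly₂ c.1 / intPoly₂ c.2

/-! ### Proper `q`-hypergeometric terms -/

/-- The quantum factorial `(x; q)_m`, `m ∈ ℤ`: it is `(1 - x) ⋯ (1 - x q ^ (m - 1))` for `m ≥ 0`
and `1 / ((1 - x q⁻¹) ⋯ (1 - x q ^ m))` for `m < 0`. -/
noncomputable def qFactorial (x : Kq) : ℤ → Kq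
  | Int.ofNat m => ∏ i ∈ Finset.range m, (1 - x * q ^ i)
  | Int.negSucc m => (∏ i ∈ Finset.range (m + 1), (1 - x * q ^ (-((i : ℤ) + 1))))⁻¹

/-- `(x; q)_m` is defined: no factor in its denominator (for `m < 0`) vanishes. -/
def QFactorialDefined (x : Kq) (m : ℤ) : Prop :=
  ∀ j : ℤ, m ≤ j → j < 0 → 1 - x * q ^ j ≠ 0

/-- `1 / (x; q)_m` is defined: no factor of `(x; q)_m` (for `m > 0`) vanishes. For `m < 0` it is
the product `(1 - x q⁻¹) ⋯ (1 - x q ^ m)`, which may be zero, as in `1 / (q; q)_{-1} = 0`. -/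
def InvQFactorialDefined (x : Kq) (m : ℤ) : Prop :=
  ∀ j : ℤ, 0 ≤ j → j < m → 1 - x * q ^ j ≠ 0

/-- The integer linear form `a n + b k + c`. -/
structure LinForm where
  a : ℤ
  b : ℤ
  c : ℤ

def LinForm.val (l : LinForm) (n k : ℕ) : ℤ :=
  l.a * n + l.b * k + l.c

/-- A quantum factorial `(x q ^ s(n,k); q)_{m(n,k)}` with `x ∈ ℚ(q)` and integer linear
forms `s`, `m`. -/
structure QFactor where
  x : RatCode
  s : LinForm
  m : LinForm

/-- The first argument `x q ^ s(n,k)` of the quantum factorial. -/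
noncomputable def QFactor.arg (f : QFactor) (n k : ℕ) : Kq :=
  f.x.val * q ^ f.s.val n k

noncomputable def QFactor.val (f : QFactor) (n k : ℕ) : Kq :=
  qFactorial (f.arg n k) (f.m.val n k)

/-- An integer-valued quadratic function of `n`, `k`:
`nn * n(n-1)/2 + nk * n k + kk * k(k-1)/2 + lin(n, k)`. -/
structure QuadForm where
  nn : ℤ
  nk : ℤ
  kk : ℤ
  lin : LinForm

def QuadForm.val (e : QuadForm) (n k : ℕ) : ℤ :=
  e.nn * (n.choose 2 : ℕ) + e.nk * (n * k) + e.kk * (k.choose 2 : ℕ) + e.lin.val n k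

/-- The expression
`p(q ^ n, q ^ k) * ξ ^ n * η ^ k * q ^ quad(n, k) * ∏ (x q ^ s; q)_m / ∏ (x' q ^ s'; q)_m'`
with a polynomial `p` over `ℚ(q)`, `ξ, η ∈ ℚ(q)`, a quadratic function `quad`, and quantum
factorials of linear forms in `n`, `k`. The entry of `poly` in position `j` is the list of the
coefficients of `(q ^ k) ^ j` as a polynomial in `q ^ n`. -/
structure TermCode where
  poly : List (List RatCode)
  ξ : RatCode
  η : RatCode
  quad : QuadForm
  num : List QFactor
  den : List QFactor

noncomputable def TermCode.val (T : TermCode) (n k : ℕ) : Kq :=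
  coeffEval (q ^ k) (T.poly.map fun l => coeffEval (q ^ n) (l.map RatCode.val)) *
    T.ξ.val ^ n * T.η.val ^ k * q ^ T.quad.val n k *
    (T.num.map fun f => f.val n k).prod * (T.den.map fun f => (f.val n k)⁻¹).prod

/-- The geometric factors do not vanish, and the expression is defined for `0 ≤ k ≤ n`. -/
def TermCode.IsValid (T : TermCode) : Prop :=
  T.ξ.val ≠ 0 ∧ T.η.val ≠ 0 ∧ ∀ n k : ℕ, k ≤ n →
    (∀ f ∈ T.num, QFactorialDefined (f.arg n k) (f.m.val n k)) ∧
    (∀ f ∈ T.den, InvQFactorialDefined (f.arg n k) (f.m.val n k))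

/-- `c(n, k)`, `0 ≤ k ≤ n`, is a proper `q`-hypergeometric term. -/
def IsProperQHypergeometric (c : ℕ → ℕ → Kq) : Prop :=
  ∃ T : TermCode, T.IsValid ∧ ∀ n k : ℕ, k ≤ n → c n k = T.val n k

/-- `J(n) = ∑_{k=0}^n c(n, k) Ĵ(k)`. -/
noncomputable def kernelSum (c : ℕ → ℕ → Kq) (Jhat : ℕ → Kq) (n : ℕ) : Kq :=
  ∑ k ∈ Finset.range (n + 1), c n k * Jhat k

/-! ### The codes as inputs of algorithms -/

def LinForm.equiv : LinForm ≃ ℤ × ℤ × ℤ where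
  toFun l := (l.a, l.b, l.c)
  invFun t := ⟨t.1, t.2.1, t.2.2⟩
  left_inv _ := rfl
  right_inv _ := rfl

instance : Primcodable LinForm := Primcodable.ofEquiv _ LinForm.equiv

def QFactor.equiv : QFactor ≃ RatCode × LinForm × LinForm where
  toFun f := (f.x, f.s, f.m)
  invFun t := ⟨t.1, t.2.1, t.2.2⟩
  left_inv _ := rfl
  right_inv _ := rfl

instance : Primcodable QFactor := Primcodable.ofEquiv _ QFactor.equiv

def QuadForm.equiv : QuadForm ≃ ℤ × ℤ × ℤ × LinForm where
  toFun e := (e.nn, e.nk, e.kk, e.lin)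
  invFun t := ⟨t.1, t.2.1, t.2.2.1, t.2.2.2⟩
  left_inv _ := rfl
  right_inv _ := rfl

instance : Primcodable QuadForm := Primcodable.ofEquiv _ QuadForm.equiv

def TermCode.equiv : TermCode ≃
    List (List RatCode) × RatCode × RatCode × QuadForm × List QFactor × List QFactor where
  toFun T := (T.poly, T.ξ, T.η, T.quad, T.num, T.den)
  invFun t := ⟨t.1, t.2.1, t.2.2.1, t.2.2.2.1, t.2.2.2.2.1, t.2.2.2.2.2⟩
  left_inv _ := rfl
  right_inv _ := rfl

instance : Primcodable TermCode := Primcodable.ofEquiv _ TermCode.equiv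

end QHolonomic

/-!
Let `F` be the fraction field of `ℚ(q)[[ε]]`, and put `z = 1 + ε`. Replacing each factor
`(x q ^ s; q)_m` by a quotient of factors `(x z; q)_{s + m}` and `(x z; q)_s`, and multiplying by a
factor which is `1` at `ε = 0` for `0 ≤ k ≤ n` and `0` for all other `k`, perturbs the summand to a
function that is defined for all integers `n`, `k` and whose shift quotients are rational functions
of `q`, `z`, `Q = q ^ n` and `K = q ^ k`.

Counting dimensions as in Sister Celine's method gives Laurent polynomials `α i j` in `q`, `z`, `Q`,
not all zero, such that `∑ i, α i j * c(n + i, k + j)` is, up to a common factor, the coefficient of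
`Ĵ(k + j)` in a combination of shifts of the given equation for `Ĵ`. Hence
`∑ i j, α i j * c(n + i, k + j) * Ĵ(k + j) = 0`. A weight `z ^ (-w * k)` on the summand ensures that
summation over `k` does not annihilate all coefficients. Cancelling the largest common power of
`z - 1 = ε` and setting `ε = 0` leaves a nontrivial equation for `J`.

The Laurent polynomials involved form a certificate whose validity is decidable and implies the
equation, so the algorithm searches through all certificates.
-/

namespace QHolonomic

open Encodable

/-! ### Primitive recursive functions -/

attribute [fun_prop] Primrec PrimrecPred Primrec.id Primrec.const Primrec.comp Primrec.fst
  Primrec.snd Primrec.pair Primrec.succ Primrec.ite PrimrecPred.and PrimrecPred.not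

section Primrec

variable {σ α β : Type*} [Primcodable σ] [Primcodable α] [Primcodable β]

@[fun_prop]
theorem primrecPred_eq {f g : σ → α} (hf : Primrec f) (hg : Primrec g) :
    PrimrecPred fun s => f s = g s :=
  Primrec.eq.comp hf hg

@[fun_prop]
theorem primrecPred_nat_le {f g : σ → ℕ} (hf : Primrec f) (hg : Primrec g) :
    PrimrecPred fun s => f s ≤ g s :=
  Primrec.nat_le.comp hf hg

@[fun_prop]
theorem primrec_nat_add {f g : σ → ℕ} (hf : Primrec f) (hg : Primrec g) :
    Primrec fun s => f s + g s :=
  Primrec.nat_add.comp hf hg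

@[fun_prop]
theorem primrec_nat_sub {f g : σ → ℕ} (hf : Primrec f) (hg : Primrec g) :
    Primrec fun s => f s - g s :=
  Primrec.nat_sub.comp hf hg

@[fun_prop]
theorem primrec_nat_mul {f g : σ → ℕ} (hf : Primrec f) (hg : Primrec g) :
    Primrec fun s => f s * g s :=
  Primrec.nat_mul.comp hf hg

@[fun_prop]
theorem primrec_nat_div {f g : σ → ℕ} (hf : Primrec f) (hg : Primrec g) :
    Primrec fun s => f s / g s :=
  Primrec.nat_div.comp hf hg

@[fun_prop]
theorem primrec_nat_rec {n : σ → ℕ} {z : σ → α} {f : σ → ℕ → α → α} (hn : Primrec n)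
    (hz : Primrec z) (hf : Primrec fun p : σ × ℕ × α => f p.1 p.2.1 p.2.2) :
    Primrec fun s => (Nat.rec (z s) (f s) (n s) : α) :=
  Primrec.nat_rec' hn hz hf.to₂

@[fun_prop]
theorem primrec_list_cons {f : σ → α} {l : σ → List α} (hf : Primrec f) (hl : Primrec l) :
    Primrec fun s => f s :: l s :=
  Primrec.list_cons.comp hf hl

@[fun_prop]
theorem primrec_list_append {l m : σ → List α} (hl : Primrec l) (hm : Primrec m) :
    Primrec fun s => l s ++ m s :=
  Primrec.list_append.comp hl hm

@[fun_prop]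
theorem primrec_list_length {l : σ → List α} (hl : Primrec l) : Primrec fun s => (l s).length :=
  Primrec.list_length.comp hl

@[fun_prop]
theorem primrec_list_range {n : σ → ℕ} (hn : Primrec n) : Primrec fun s => List.range (n s) :=
  Primrec.list_range.comp hn

@[fun_prop]
theorem primrec_list_getD {l : σ → List α} {n : σ → ℕ} (hl : Primrec l) (hn : Primrec n) (d : α) :
    Primrec fun s => (l s).getD (n s) d :=
  (Primrec.list_getD d).comp hl hn

@[fun_prop]
theorem primrec_list_map {l : σ → List α} {f : σ → α → β} (hl : Primrec l)
    (hf : Primrec fun p : σ × α => f p.1 p.2) : Primrec fun s => (l s).map (f s) :=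
  Primrec.list_map hl hf.to₂

@[fun_prop]
theorem primrec_list_flatMap {l : σ → List α} {f : σ → α → List β} (hl : Primrec l)
    (hf : Primrec fun p : σ × α => f p.1 p.2) : Primrec fun s => (l s).flatMap (f s) :=
  Primrec.list_flatMap hl hf.to₂

@[fun_prop]
theorem primrec_list_foldr {l : σ → List α} {b : σ → β} {f : σ → α → β → β} (hl : Primrec l)
    (hb : Primrec b) (hf : Primrec fun p : σ × α × β => f p.1 p.2.1 p.2.2) :
    Primrec fun s => (l s).foldr (f s) (b s) :=
  Primrec.list_foldr hl hb hf.to₂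

@[fun_prop]
theorem primrecPred_forall_mem {l : σ → List α} {p : σ → α → Prop} (hl : Primrec l)
    (hp : PrimrecPred fun x : σ × α => p x.1 x.2) : PrimrecPred fun s => ∀ x ∈ l s, p s x :=
  (PrimrecRel.forall_mem_list (R := fun x s => p s x)
    (hp.comp (Primrec.snd.pair Primrec.fst))).comp hl Primrec.id

@[fun_prop]
theorem primrecPred_exists_mem {l : σ → List α} {p : σ → α → Prop} (hl : Primrec l)
    (hp : PrimrecPred fun x : σ × α => p x.1 x.2) : PrimrecPred fun s => ∃ x ∈ l s, p s x :=
  (PrimrecRel.exists_mem_list (R := fun x s => p s x)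
    (hp.comp (Primrec.snd.pair Primrec.fst))).comp hl Primrec.id

theorem encode_natCast (n : ℕ) : encode (n : ℤ) = 2 * n := rfl

theorem encode_negSucc (n : ℕ) : encode (Int.negSucc n) = 2 * n + 1 := rfl

@[fun_prop]
theorem primrec_int_natCast {f : σ → ℕ} (hf : Primrec f) : Primrec fun s => (f s : ℤ) :=
  (Primrec.encode_iff.1 Primrec.nat_double).comp hf

@[fun_prop]
theorem primrec_int_negSucc {f : σ → ℕ} (hf : Primrec f) : Primrec fun s => Int.negSucc (f s) :=
  (Primrec.encode_iff.1 Primrec.nat_double_succ).comp hf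

theorem primrec_int_casesOn {x : σ → ℤ} {f g : σ → ℕ → α} (hx : Primrec x)
    (hf : Primrec fun p : σ × ℕ => f p.1 p.2) (hg : Primrec fun p : σ × ℕ => g p.1 p.2) :
    Primrec fun s => (Int.casesOn (x s) (f s) (g s) : α) := by
  have div2_encode : Primrec fun s => (encode (x s)).div2 :=
    Primrec.nat_div2.comp (Primrec.encode.comp hx)
  have bodd_encode : Primrec fun s => (encode (x s)).bodd :=
    Primrec.nat_bodd.comp (Primrec.encode.comp hx)
  refine (Primrec.cond bodd_encode (hg.comp (Primrec.id.pair div2_encode))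
    (hf.comp (Primrec.id.pair div2_encode))).of_eq fun s => ?_
  rcases x s with n | n
  · simp [encode_natCast]
  · simp [encode_negSucc]

@[fun_prop]
theorem primrec_int_toNat {x : σ → ℤ} (hx : Primrec x) : Primrec fun s => (x s).toNat :=
  (primrec_int_casesOn hx (f := fun _ n => n) (g := fun _ _ => 0) (by fun_prop)
    (by fun_prop)).of_eq fun s => by cases x s <;> rfl

@[fun_prop]
theorem primrec_int_neg {x : σ → ℤ} (hx : Primrec x) : Primrec fun s => -x s :=
  (primrec_int_casesOn hx (f := fun _ n => if n = 0 then 0 else Int.negSucc (n - 1))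
    (g := fun _ n => ((n + 1 : ℕ) : ℤ)) (by fun_prop) (by fun_prop)).of_eq fun s => by
      rcases x s with (_ | n) | n <;> rfl

theorem primrec_int_natCast_sub {f g : σ → ℕ} (hf : Primrec f) (hg : Primrec g) :
    Primrec fun s => (f s : ℤ) - g s :=
  (show Primrec fun s => if g s ≤ f s then ((f s - g s : ℕ) : ℤ) else -((g s - f s : ℕ) : ℤ) by
    fun_prop).of_eq fun s => by split_ifs <;> omega

@[fun_prop]
theorem primrec_int_add {x y : σ → ℤ} (hx : Primrec x) (hy : Primrec y) :
    Primrec fun s => x s + y s :=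
  (primrec_int_natCast_sub
    (f := fun s => (x s).toNat + (y s).toNat) (g := fun s => (-x s).toNat + (-y s).toNat)
    (by fun_prop) (by fun_prop)).of_eq fun s => by omega

@[fun_prop]
theorem primrec_int_sub {x y : σ → ℤ} (hx : Primrec x) (hy : Primrec y) :
    Primrec fun s => x s - y s :=
  (primrec_int_add hx (primrec_int_neg hy)).of_eq fun _ => (sub_eq_add_neg _ _).symm

@[fun_prop]
theorem primrec_int_mul {x y : σ → ℤ} (hx : Primrec x) (hy : Primrec y) :
    Primrec fun s => x s * y s :=
  (primrec_int_natCast_sub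
    (f := fun s => (x s).toNat * (y s).toNat + (-x s).toNat * (-y s).toNat)
    (g := fun s => (x s).toNat * (-y s).toNat + (-x s).toNat * (y s).toNat)
    (by fun_prop) (by fun_prop)).of_eq fun s => by
      conv_rhs => rw [← Int.toNat_sub_toNat_neg (x s), ← Int.toNat_sub_toNat_neg (y s)]
      push_cast
      ring

@[fun_prop]
theorem primrec_int_natAbs {x : σ → ℤ} (hx : Primrec x) : Primrec fun s => (x s).natAbs :=
  (show Primrec fun s => (x s).toNat + (-x s).toNat by fun_prop).of_eq fun s => by omega

end Primrec

/-! ### Codes of elements of group rings -/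

/-- The addition of `G` is primitive recursive. -/
class PrimrecAdd (G : Type*) [Primcodable G] [Add G] : Prop where
  primrec_add : Primrec₂ ((· + ·) : G → G → G)

instance : PrimrecAdd ℤ where
  primrec_add := primrec_int_add Primrec.fst Primrec.snd

@[fun_prop]
theorem primrec_add {σ G : Type*} [Primcodable σ] [Primcodable G] [Add G] [PrimrecAdd G]
    {f g : σ → G} (hf : Primrec f) (hg : Primrec g) : Primrec fun s => f s + g s :=
  PrimrecAdd.primrec_add.comp hf hg

instance {G H : Type*} [Primcodable G] [Primcodable H] [Add G] [Add H] [PrimrecAdd G]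
    [PrimrecAdd H] : PrimrecAdd (G × H) where
  primrec_add := by
    change Primrec fun p : (G × H) × (G × H) => (p.1.1 + p.2.1, p.1.2 + p.2.2)
    fun_prop

/-- A finite description of an element of the group ring `ℤ[G]`: the list of its terms, each given
by its coefficient and its group element. Repetitions and zero coefficients are allowed. -/
structure GroupRingCode (G : Type*) where
  terms : List (ℤ × G)

namespace GroupRingCode

section Operations

variable {G : Type*}

def equiv : GroupRingCode G ≃ List (ℤ × G) where
  toFun l := l.terms
  invFun l := ⟨l⟩
  left_inv _ := rfl
  right_inv _ := rfl

instance [Primcodable G] : Primcodable (GroupRingCode G) := Primcodable.ofEquiv _ equiv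

/-- The code of the basis element of `g`. -/
def single (g : G) : GroupRingCode G := ⟨[(1, g)]⟩

/-- The code of the constant `c`. -/
def const [Zero G] (c : ℤ) : GroupRingCode G := ⟨[(c, 0)]⟩

instance : Zero (GroupRingCode G) := ⟨⟨[]⟩⟩

instance [Zero G] : One (GroupRingCode G) := ⟨const 1⟩

instance : Add (GroupRingCode G) := ⟨fun l m => ⟨l.terms ++ m.terms⟩⟩

instance : Sub (GroupRingCode G) := ⟨fun l m => ⟨l.terms ++ m.terms.map fun x => (-x.1, x.2)⟩⟩

instance [Add G] : Mul (GroupRingCode G) :=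
  ⟨fun l m => ⟨l.terms.flatMap fun x => m.terms.map fun y => (x.1 * y.1, x.2 + y.2)⟩⟩

instance [AddMonoid G] : Pow (GroupRingCode G) ℕ := ⟨fun l n => Nat.rec 1 (fun _ m => m * l) n⟩

/-- The code of the image under `ℤ[G] → ℤ[H]`. -/
def map {H : Type*} (f : G → H) (l : GroupRingCode G) : GroupRingCode H :=
  ⟨l.terms.map fun x => (x.1, f x.2)⟩

/-- The polynomial with the given list of coefficients, constant coefficient first, evaluated at
`x`. It is the counterpart of `coeffEval`, which requires a semiring. -/
def horner [Add G] (x : GroupRingCode G) (l : List (GroupRingCode G)) : GroupRingCode G :=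
  l.foldr (fun c s => c + x * s) 0

variable [DecidableEq G]

/-- The coefficient of `g`, collected from all terms. -/
def coeff (l : GroupRingCode G) (g : G) : ℤ :=
  (l.terms.map fun x => if x.2 = g then x.1 else 0).sum

/-- The code describes `0`, see `isZero_iff`. -/
def IsZero (l : GroupRingCode G) : Prop := ∀ x ∈ l.terms, l.coeff x.2 = 0

instance : DecidablePred (IsZero (G := G)) := fun _ => inferInstanceAs (Decidable (∀ _ ∈ _, _))

end Operations

section Primrec

variable {σ G : Type*} [Primcodable σ] [Primcodable G]

@[fun_prop]
theorem primrec_terms {l : σ → GroupRingCode G} (hl : Primrec l) : Primrec fun s => (l s).terms :=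
  (Primrec.of_equiv (e := equiv)).comp hl

@[fun_prop]
theorem primrec_mk {l : σ → List (ℤ × G)} (hl : Primrec l) :
    Primrec fun s => (⟨l s⟩ : GroupRingCode G) :=
  (Primrec.of_equiv_symm (e := equiv)).comp hl

@[fun_prop]
theorem primrec_single {g : σ → G} (hg : Primrec g) : Primrec fun s => single (g s) := by
  unfold single
  fun_prop

@[fun_prop]
theorem primrec_const [Zero G] {c : σ → ℤ} (hc : Primrec c) :
    Primrec fun s => (const (c s) : GroupRingCode G) := by
  unfold const
  fun_prop

@[fun_prop]
theorem primrec_add {l m : σ → GroupRingCode G} (hl : Primrec l) (hm : Primrec m) :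
    Primrec fun s => l s + m s := by
  change Primrec fun s => GroupRingCode.mk _
  fun_prop

@[fun_prop]
theorem primrec_sub {l m : σ → GroupRingCode G} (hl : Primrec l) (hm : Primrec m) :
    Primrec fun s => l s - m s := by
  change Primrec fun s => GroupRingCode.mk _
  fun_prop

@[fun_prop]
theorem primrec_mul [Add G] [PrimrecAdd G] {l m : σ → GroupRingCode G} (hl : Primrec l)
    (hm : Primrec m) : Primrec fun s => l s * m s := by
  change Primrec fun s => GroupRingCode.mk _
  fun_prop

@[fun_prop]
theorem primrec_pow [AddMonoid G] [PrimrecAdd G] {l : σ → GroupRingCode G} {n : σ → ℕ}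
    (hl : Primrec l) (hn : Primrec n) : Primrec fun s => l s ^ n s :=
  primrec_nat_rec (f := fun s _ m => m * l s) hn (Primrec.const 1) (by fun_prop)

@[fun_prop]
theorem primrec_list_sum {l : σ → List (GroupRingCode G)} (hl : Primrec l) :
    Primrec fun s => (l s).sum :=
  primrec_list_foldr hl (Primrec.const 0) (by fun_prop)

@[fun_prop]
theorem primrec_list_prod [AddMonoid G] [PrimrecAdd G] {l : σ → List (GroupRingCode G)}
    (hl : Primrec l) : Primrec fun s => (l s).prod :=
  primrec_list_foldr hl (Primrec.const 1) (by fun_prop)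

@[fun_prop]
theorem primrec_map {H : Type*} [Primcodable H] {f : G → H} (hf : Primrec f)
    {l : σ → GroupRingCode G} (hl : Primrec l) : Primrec fun s => (l s).map f := by
  unfold map
  fun_prop

@[fun_prop]
theorem primrec_horner [Add G] [PrimrecAdd G] {x : σ → GroupRingCode G}
    {l : σ → List (GroupRingCode G)} (hx : Primrec x) (hl : Primrec l) :
    Primrec fun s => horner (x s) (l s) := by
  unfold horner
  fun_prop

@[fun_prop]
theorem primrec_coeff [DecidableEq G] {l : σ → GroupRingCode G} {g : σ → G} (hl : Primrec l)
    (hg : Primrec g) : Primrec fun s => (l s).coeff (g s) :=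
  primrec_list_foldr (f := fun _ x y => x + y)
    (primrec_list_map (primrec_terms hl) (by fun_prop)) (Primrec.const 0) (by fun_prop)

@[fun_prop]
theorem primrecPred_isZero [DecidableEq G] {l : σ → GroupRingCode G} (hl : Primrec l) :
    PrimrecPred fun s => (l s).IsZero := by
  unfold IsZero
  fun_prop

end Primrec

section Value

variable {G : Type*}

/-- The element of `ℤ[G]` described by a code. -/
noncomputable def val (l : GroupRingCode G) : AddMonoidAlgebra ℤ G :=
  (l.terms.map fun x => AddMonoidAlgebra.single x.2 x.1).sum

@[simp]
theorem val_zero : val (0 : GroupRingCode G) = 0 := rfl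

@[simp]
theorem val_single (g : G) : (single g).val = AddMonoidAlgebra.single g 1 := List.sum_singleton

@[simp]
theorem val_add (l m : GroupRingCode G) : (l + m).val = l.val + m.val := by
  change (List.map _ (l.terms ++ m.terms)).sum = _
  rw [List.map_append, List.sum_append]
  rfl

@[simp]
theorem val_sub (l m : GroupRingCode G) : (l - m).val = l.val - m.val := by
  change (List.map _ (l.terms ++ m.terms.map _)).sum = _
  simp [val, List.sum_neg, Function.comp_def, sub_eq_add_neg]

section AddMonoid

variable [AddMonoid G]

@[simp]
theorem val_const (c : ℤ) : (const c : GroupRingCode G).val = c := by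
  simp [const, val, AddMonoidAlgebra.intCast_def]

@[simp]
theorem val_one : (1 : GroupRingCode G).val = 1 := (val_const 1).trans Int.cast_one

@[simp]
theorem val_mul (l m : GroupRingCode G) : (l * m).val = l.val * m.val := by
  change (List.map _ (l.terms.flatMap _)).sum = _
  simp only [val, List.flatMap_def, List.map_flatten, List.sum_flatten, List.map_map,
    Function.comp_def, ← AddMonoidAlgebra.single_mul_single, List.sum_map_mul_left,
    List.sum_map_mul_right]

@[simp]
theorem val_pow (l : GroupRingCode G) (n : ℕ) : (l ^ n).val = l.val ^ n := by
  induction n with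
  | zero => exact val_one
  | succ n ih => rw [pow_succ, ← ih]; exact val_mul (l ^ n) l

@[simp]
theorem val_list_prod (l : List (GroupRingCode G)) : l.prod.val = (l.map val).prod := by
  induction l <;> simp [*]

theorem val_map {H : Type*} [AddMonoid H] (f : G →+ H) (l : GroupRingCode G) :
    (l.map f).val = AddMonoidAlgebra.mapDomainRingHom ℤ f l.val := by
  simp [val, map, Function.comp_def, map_list_sum]

theorem val_horner (x : GroupRingCode G) (l : List (GroupRingCode G)) :
    (horner x l).val = coeffEval x.val (l.map val) := by
  induction l with
  | nil => rfl
  | cons c l ih =>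
    change (c + x * horner x l).val = c.val + x.val * coeffEval x.val (l.map val)
    rw [val_add, val_mul, ih]

end AddMonoid

@[simp]
theorem val_list_sum (l : List (GroupRingCode G)) : l.sum.val = (l.map val).sum := by
  induction l <;> simp [*]

theorem coeff_val [DecidableEq G] (l : GroupRingCode G) (g : G) : l.val.coeff g = l.coeff g := by
  obtain ⟨l⟩ := l
  induction l with
  | nil => rfl
  | cons x l ih => simp_all [val, coeff, Finsupp.single_apply]

theorem isZero_iff [DecidableEq G] (l : GroupRingCode G) : l.IsZero ↔ l.val = 0 := by
  refine ⟨fun h => ?_, fun h x _ => by simp [← coeff_val, h]⟩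
  ext g
  rw [coeff_val]
  by_cases hg : ∃ x ∈ l.terms, x.2 = g
  · obtain ⟨x, hx, rfl⟩ := hg
    exact h x hx
  · push Not at hg
    refine List.sum_eq_zero fun c hc => ?_
    obtain ⟨x, hx, rfl⟩ := List.mem_map.1 hc
    exact if_neg (hg x hx)

theorem val_surjective : Function.Surjective (val : GroupRingCode G → AddMonoidAlgebra ℤ G) := by
  intro p
  induction p using AddMonoidAlgebra.induction_linear with
  | zero => exact ⟨0, val_zero⟩
  | add _ _ hp hq =>
    obtain ⟨l, rfl⟩ := hp
    obtain ⟨m, rfl⟩ := hq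
    exact ⟨l + m, val_add l m⟩
  | single g c => exact ⟨⟨[(c, g)]⟩, List.sum_singleton⟩

end Value

end GroupRingCode

open Encodable GroupRingCode

/-! ### Certificates -/

/-- Codes of Laurent polynomials in `q`, `z`, `Q`: the exponents of `q ^ a * z ^ b * Q ^ c` are
listed as `(a, b, c)`. -/
abbrev CoeffCode : Type := GroupRingCode (ℤ × ℤ × ℤ)

/-- Codes of Laurent polynomials in `K`, `q`, `z`, `Q`: the exponents of
`K ^ d * q ^ a * z ^ b * Q ^ c` are listed as `(d, a, b, c)`. Here `K` stands for `q ^ k`. -/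
abbrev LaurentCode : Type := GroupRingCode (ℤ × ℤ × ℤ × ℤ)

section Polynomials

variable {G : Type*} [AddMonoid G]

/-- The counterpart of `intPoly`, with `q` given as a code. -/
def intCode (q : GroupRingCode G) (l : List ℤ) : GroupRingCode G := horner q (l.map const)

/-- The counterpart of `intPoly₂`, with `q` and the point of evaluation given as codes. -/
def intCode₂ (q x : GroupRingCode G) (l : List (List ℤ)) : GroupRingCode G :=
  horner x (l.map (intCode q))

/-- Horner's rule for numerators and denominators, without cancellation. -/
def fracHorner (x : GroupRingCode G) (l : List (GroupRingCode G × GroupRingCode G)) :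
    GroupRingCode G × GroupRingCode G :=
  l.foldr (fun c s => (c.1 * s.2 + x * (s.1 * c.2), c.2 * s.2)) (0, 1)

end Polynomials

/-- The list describes the zero polynomial, see `intPoly_eq_zero_iff`. -/
def AllZero (l : List ℤ) : Prop := ∀ c ∈ l, c = 0

/-- The counterpart of `AllZero` for `intPoly₂`. -/
def AllZero₂ (l : List (List ℤ)) : Prop := ∀ m ∈ l, AllZero m

instance : DecidablePred AllZero := fun _ => inferInstanceAs (Decidable (∀ _ ∈ _, _))

instance : DecidablePred AllZero₂ := fun _ => inferInstanceAs (Decidable (∀ _ ∈ _, _))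

/-- The numerator of `r`, or `0` if the denominator of `r` vanishes, in which case `r.val = 0`. -/
def RatCode.num (r : RatCode) : List ℤ := if AllZero r.2 then [] else r.1

/-- The denominator of `r`, replaced by `1` if it vanishes. -/
def RatCode.den (r : RatCode) : List ℤ := if AllZero r.2 then [1] else r.2

/-- The code of `q`. -/
def qCode : LaurentCode := single (0, 1, 0, 0)

/-- The polynomial factor of a term at `(n + i, k + j)`, as a numerator and a denominator. -/
def polyCode (p : List (List RatCode)) (i j : ℕ) : LaurentCode × LaurentCode :=
  fracHorner (single (1, j, 0, 0)) (p.map fun l =>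
    fracHorner (single (0, i, 0, 1)) (l.map fun r => (intCode qCode r.num, intCode qCode r.den)))

/-- The quotient of the power of `q` at `(n + i, k + j)` by the one at `(n, k)`. -/
def quadCode (e : QuadForm) (i j : ℕ) : LaurentCode :=
  single (e.nk * i + e.kk * j,
    e.nn * ((i * (i - 1) / 2 : ℕ) : ℤ) + e.nk * ((i * j : ℕ) : ℤ) +
      e.kk * ((j * (j - 1) / 2 : ℕ) : ℤ) + e.lin.a * i + e.lin.b * j,
    0, e.nn * i + e.nk * j)

/-- The quotient `ξ ^ (n + i) / ξ ^ n`, multiplied by the `N`-th power of the denominator of the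
code `r` of `ξ`. -/
def powCode (r : RatCode) (N i : ℕ) : LaurentCode :=
  intCode qCode r.1 ^ i * intCode qCode r.2 ^ (N - i)

namespace LinForm

/-- The form `l + t`. -/
def shift (l : LinForm) (t : ℤ) : LinForm := ⟨l.a, l.b, l.c + t⟩

instance : Add LinForm := ⟨fun l m => ⟨l.a + m.a, l.b + m.b, l.c + m.c⟩⟩

instance : Neg LinForm := ⟨fun l => ⟨-l.a, -l.b, -l.c⟩⟩

end LinForm

/-- The function `G (form (n, k))`, where `G s = (y; q)_s`, or `G s = 1 / (y; q)_{-s}` if `inverse`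
is set. Here `y` is `x z` or `x`, according to `perturbed`. Both kinds of `G` satisfy a recurrence
`G (s + 1) = (1 - y q ^ s) G s` or `G (s + 1) = (1 - y q ^ (-s - 1)) G s` on `ℤ`. -/
structure ShiftFactor where
  x : RatCode
  perturbed : Bool
  form : LinForm
  inverse : Bool

namespace ShiftFactor

def equiv : ShiftFactor ≃ RatCode × Bool × LinForm × Bool where
  toFun f := (f.x, f.perturbed, f.form, f.inverse)
  invFun t := ⟨t.1, t.2.1, t.2.2.1, t.2.2.2⟩
  left_inv _ := rfl
  right_inv _ := rfl

instance : Primcodable ShiftFactor := Primcodable.ofEquiv _ equiv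

/-- The exponent of `q` in the recurrence of `G`, at `s = form + t`. -/
def exponent (f : ShiftFactor) (t : ℤ) : LinForm :=
  bif f.inverse then (-f.form).shift (-t - 1) else f.form.shift t

/-- The factor of the recurrence of `G` at `s = form + t`, multiplied by the denominator of `x`. -/
def ratioCode (f : ShiftFactor) (t : ℤ) : LaurentCode :=
  intCode qCode f.x.den - intCode qCode f.x.num * single ((f.exponent t).b, (f.exponent t).c,
    bif f.perturbed then 1 else 0, (f.exponent t).a)

/-- A bound for the difference of `form` between `(n + i, k + j)`, `i, j ≤ N`, and `(n, k)`. -/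
def range (f : ShiftFactor) (N : ℕ) : ℕ := (f.form.a.natAbs + f.form.b.natAbs) * N

/-- The difference of `form (n + i, k + j)` and `form (n, k) - f.range N`. -/
def offset (f : ShiftFactor) (N i j : ℕ) : ℕ := (f.form.a * i + f.form.b * j + f.range N).toNat

/-- The quotient of `G (form (n + i, k + j))` by `G (form (n, k) - f.range N)`, up to a constant
factor. -/
def code (f : ShiftFactor) (N i j : ℕ) : LaurentCode :=
  ((List.range (f.offset N i j)).map fun t : ℕ => f.ratioCode (t - f.range N)).prod *
    intCode qCode f.x.den ^ (2 * f.range N - f.offset N i j)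

end ShiftFactor

/-- The perturbation `(x z q ^ s; q)_m = (x z; q)_{s + m} / (x z; q)_s` of a quantum factorial. -/
def QFactor.shiftFactors (f : QFactor) : List ShiftFactor :=
  [⟨f.x, true, f.s + f.m, false⟩, ⟨f.x, true, -f.s, true⟩]

/-- The perturbation of the inverse of a quantum factorial. -/
def QFactor.invShiftFactors (f : QFactor) : List ShiftFactor :=
  [⟨f.x, true, f.s, false⟩, ⟨f.x, true, -(f.s + f.m), true⟩]

/-- The factor `(q z; q)_k (q z; q)_{n - k} / ((q; q)_k (q; q)_{n - k})`. It vanishes outside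
`0 ≤ k ≤ n`, where it is a perturbation of `1`. -/
def boundaryFactors : List ShiftFactor :=
  [⟨([0, 1], [1]), true, ⟨0, 1, 0⟩, false⟩, ⟨([0, 1], [1]), true, ⟨1, -1, 0⟩, false⟩,
    ⟨([0, 1], [1]), false, ⟨0, -1, 0⟩, true⟩, ⟨([0, 1], [1]), false, ⟨-1, 1, 0⟩, true⟩]

namespace TermCode

/-- The perturbation of the quantum factorials of a term, together with the factors that confine
its support to `0 ≤ k ≤ n`. -/
def shiftFactors (T : TermCode) : List ShiftFactor :=
  T.num.flatMap QFactor.shiftFactors ++ (T.den.flatMap QFactor.invShiftFactors ++ boundaryFactors)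

/-- The perturbed term at `(n + i, k + j)`, up to a factor that does not depend on
`i, j ≤ N`. -/
def shiftCode (T : TermCode) (N i j : ℕ) : LaurentCode :=
  (polyCode T.poly i j).1 * powCode T.ξ N i * powCode T.η N j * quadCode T.quad i j *
    (T.shiftFactors.map fun f => f.code N i j).prod

end TermCode

namespace EqCode

/-- The numerator of the coefficient `a_i`, or `0` if its denominator vanishes or there is no such
coefficient. -/
def num (P : EqCode) (i : ℕ) : List (List ℤ) :=
  if AllZero₂ (P.getD i ([], [[1]])).2 then [] else (P.getD i ([], [[1]])).1

/-- The denominator of the coefficient `a_i`, replaced by `1` if it vanishes or there is no such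
coefficient. -/
def den (P : EqCode) (i : ℕ) : List (List ℤ) :=
  if AllZero₂ (P.getD i ([], [[1]])).2 then [[1]] else (P.getD i ([], [[1]])).2

/-- The coefficient `a_i` of an equation at `Q = x`, multiplied by the product of all denominators,
once more by this product, and by `(1 - q x) (1 - q ^ 2 x) ⋯`. The last two factors make the
equation valid at every `x = q ^ m`, `m ∈ ℤ`, for a sequence extended by `0`. -/
def coeffCode (P : EqCode) (x : LaurentCode) (i : ℕ) : LaurentCode :=
  intCode₂ qCode x (P.num i) *
    ((List.range P.length).map fun l => if l = i then 1 else intCode₂ qCode x (P.den l)).prod *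
    ((List.range P.length).map fun l => intCode₂ qCode x (P.den l)).prod *
    ((List.range P.length).map fun t => 1 - qCode ^ (t + 1) * x).prod

end EqCode

/-- A certificate for an equation `∑ i, A_i(q, q ^ n) J(n + i) = 0` satisfied by the sum. It is
valid if the Laurent polynomials `termRelation` and `sumRelation` vanish, and if `A ≠ 0`. The
accessors `α`, `β`, `A`, `B` extend its lists by zero. -/
structure Certificate where
  order : ℕ
  weight : ℕ
  multiplicity : ℕ
  recurrence : List (List CoeffCode)
  cofactors : List LaurentCode
  result : List (List (List ℤ))
  remainders : List CoeffCode

namespace Certificate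

def equiv : Certificate ≃ ℕ × ℕ × ℕ × List (List CoeffCode) × List LaurentCode ×
    List (List (List ℤ)) × List CoeffCode where
  toFun c := (c.order, c.weight, c.multiplicity, c.recurrence, c.cofactors, c.result, c.remainders)
  invFun t := ⟨t.1, t.2.1, t.2.2.1, t.2.2.2.1, t.2.2.2.2.1, t.2.2.2.2.2.1, t.2.2.2.2.2.2⟩
  left_inv _ := rfl
  right_inv _ := rfl

instance : Primcodable Certificate := Primcodable.ofEquiv _ equiv

/-- The coefficients of the recurrence for the perturbed summand. -/
def α (c : Certificate) (i j : ℕ) : CoeffCode := (c.recurrence.getD i []).getD j 0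

/-- The coefficients of the combination of shifts of the given equation. -/
def β (c : Certificate) (l : ℕ) : LaurentCode := c.cofactors.getD l 0

/-- The coefficients of the equation for the sum. -/
def A (c : Certificate) (i : ℕ) : List (List ℤ) := c.result.getD i []

/-- The higher terms in the expansion in powers of `z - 1`, see `sumRelation`. -/
def B (c : Certificate) (i : ℕ) : CoeffCode := c.remainders.getD i 0

/-- The coefficient of `Ĵ(k + j)` in the recurrence with coefficients `α`, applied to the perturbed
summand, minus that in the combination of shifts of the given equation with coefficients `β`. -/
def termRelation (P : EqCode) (T : TermCode) (c : Certificate) (j : ℕ) : LaurentCode :=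
  ((List.range (c.order + 1)).map fun i =>
      (c.α i j).map (fun m => ((0 : ℤ), m)) * T.shiftCode c.order i j).sum -
    ((List.range (c.order + 2 - P.length)).map fun l =>
      if l ≤ j then c.β l * P.coeffCode (single (1, (l : ℤ), 0, 0)) (j - l) else 0).sum

/-- The code of `z - 1`. -/
def zSubOne : CoeffCode := single (0, 1, 0) - 1

/-- The coefficient of `J(n + i)` in the sum over `k` of the recurrence with coefficients `α`, for
the summand weighted by `z ^ (-weight * k)`, minus its expansion in powers of `z - 1`. -/
def sumRelation (c : Certificate) (i : ℕ) : CoeffCode :=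
  ((List.range (c.order + 1)).map fun j => c.α i j * single (0, ((c.weight * j : ℕ) : ℤ), 0)).sum -
    zSubOne ^ c.multiplicity *
      (intCode₂ (single (1, 0, 0)) (single (0, 0, 1)) (c.A i) + zSubOne * c.B i)

/-- The two relations hold, and the equation for the sum is nontrivial. -/
def IsValid (P : EqCode) (T : TermCode) (c : Certificate) : Prop :=
  (∀ j ∈ List.range (c.order + 1), (c.termRelation P T j).IsZero) ∧
    (∀ i ∈ List.range (c.order + 1), (c.sumRelation i).IsZero) ∧
    ∃ i ∈ List.range (c.order + 1), ¬AllZero₂ (c.A i)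

instance (P : EqCode) (T : TermCode) : DecidablePred (IsValid P T) := fun _ =>
  inferInstanceAs (Decidable ((∀ _ ∈ _, _) ∧ (∀ _ ∈ _, _) ∧ ∃ _ ∈ _, _))

/-- The code of the equation for the sum. -/
def output (c : Certificate) : EqCode := (List.range (c.order + 1)).map fun i => (c.A i, [[1]])

end Certificate

/-- The search for a valid certificate, through all natural numbers. -/
def certSearch (s : EqCode × TermCode) : Part EqCode :=
  Nat.rfindOpt fun n => (decode (α := Certificate) n).bind fun c =>
    if c.IsValid s.1 s.2 then some c.output else none

theorem exists_mem_certSearch {P : EqCode} {T : TermCode} {c : Certificate} (hc : c.IsValid P T) :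
    ∃ c : Certificate, c.IsValid P T ∧ c.output ∈ certSearch (P, T) := by
  have hdom : (certSearch (P, T)).Dom := by
    refine Nat.rfindOpt_dom.2 ⟨encode c, c.output, ?_⟩
    rw [encodek, Option.bind_some, if_pos hc, Option.mem_some_iff]
  obtain ⟨n, hn⟩ := Nat.rfindOpt_spec (Part.get_mem hdom)
  obtain ⟨c', -, hc'⟩ := Option.bind_eq_some_iff.1 hn
  split_ifs at hc' with hvalid
  exact ⟨c', hvalid, Option.some.inj hc' ▸ Part.get_mem hdom⟩

section Primrec

variable {σ : Type*} [Primcodable σ]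

section Polynomials

variable {G : Type*} [AddMonoid G] [Primcodable G] [PrimrecAdd G] {x y : σ → GroupRingCode G}

@[fun_prop]
theorem primrec_intCode {l : σ → List ℤ} (hx : Primrec x) (hl : Primrec l) :
    Primrec fun s => intCode (x s) (l s) := by
  unfold intCode
  fun_prop

@[fun_prop]
theorem primrec_intCode₂ {l : σ → List (List ℤ)} (hx : Primrec x) (hy : Primrec y)
    (hl : Primrec l) : Primrec fun s => intCode₂ (x s) (y s) (l s) := by
  unfold intCode₂
  fun_prop

@[fun_prop]
theorem primrec_fracHorner {l : σ → List (GroupRingCode G × GroupRingCode G)} (hx : Primrec x)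
    (hl : Primrec l) : Primrec fun s => fracHorner (x s) (l s) := by
  unfold fracHorner
  fun_prop

end Polynomials

@[fun_prop]
theorem primrecPred_allZero {l : σ → List ℤ} (hl : Primrec l) :
    PrimrecPred fun s => AllZero (l s) := by
  unfold AllZero
  fun_prop

@[fun_prop]
theorem primrecPred_allZero₂ {l : σ → List (List ℤ)} (hl : Primrec l) :
    PrimrecPred fun s => AllZero₂ (l s) := by
  unfold AllZero₂
  fun_prop

@[fun_prop]
theorem primrec_num {r : σ → RatCode} (hr : Primrec r) : Primrec fun s => (r s).num := by
  unfold RatCode.num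
  fun_prop

@[fun_prop]
theorem primrec_den {r : σ → RatCode} (hr : Primrec r) : Primrec fun s => (r s).den := by
  unfold RatCode.den
  fun_prop

@[fun_prop]
theorem primrec_bif {α : Type*} [Primcodable α] {c : σ → Bool} {f g : σ → α} (hc : Primrec c)
    (hf : Primrec f) (hg : Primrec g) : Primrec fun s => bif c s then f s else g s :=
  Primrec.cond hc hf hg

section LinForm

variable {l m : σ → LinForm} (hl : Primrec l) (hm : Primrec m)

@[fun_prop]
theorem primrec_linForm_mk {a b c : σ → ℤ} (ha : Primrec a) (hb : Primrec b) (hc : Primrec c) :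
    Primrec fun s => (⟨a s, b s, c s⟩ : LinForm) :=
  (Primrec.of_equiv_symm (e := LinForm.equiv)).comp (ha.pair (hb.pair hc))

include hl

theorem primrec_linForm_equiv : Primrec fun s => LinForm.equiv (l s) := Primrec.of_equiv.comp hl

@[fun_prop]
theorem primrec_linForm_a : Primrec fun s => (l s).a := Primrec.fst.comp (primrec_linForm_equiv hl)

@[fun_prop]
theorem primrec_linForm_b : Primrec fun s => (l s).b :=
  Primrec.fst.comp (Primrec.snd.comp (primrec_linForm_equiv hl))

@[fun_prop]
theorem primrec_linForm_c : Primrec fun s => (l s).c :=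
  Primrec.snd.comp (Primrec.snd.comp (primrec_linForm_equiv hl))

@[fun_prop]
theorem primrec_linForm_shift {t : σ → ℤ} (ht : Primrec t) :
    Primrec fun s => (l s).shift (t s) := by
  unfold LinForm.shift
  fun_prop

@[fun_prop]
theorem primrec_linForm_neg : Primrec fun s => -l s := by
  change Primrec fun s => LinForm.mk _ _ _
  fun_prop

include hm

@[fun_prop]
theorem primrec_linForm_add : Primrec fun s => l s + m s := by
  change Primrec fun s => LinForm.mk _ _ _
  fun_prop

end LinForm

section QuadForm

variable {e : σ → QuadForm} (he : Primrec e)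
include he

theorem primrec_quadForm_equiv : Primrec fun s => QuadForm.equiv (e s) := Primrec.of_equiv.comp he

@[fun_prop]
theorem primrec_quadCode {i j : σ → ℕ} (hi : Primrec i) (hj : Primrec j) :
    Primrec fun s => quadCode (e s) (i s) (j s) := by
  have h := primrec_quadForm_equiv he
  have hnn : Primrec fun s => (e s).nn := Primrec.fst.comp h
  have hnk : Primrec fun s => (e s).nk := Primrec.fst.comp (Primrec.snd.comp h)
  have hkk : Primrec fun s => (e s).kk := Primrec.fst.comp (Primrec.snd.comp (Primrec.snd.comp h))
  have hlin : Primrec fun s => (e s).lin := Primrec.snd.comp (Primrec.snd.comp (Primrec.snd.comp h))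
  unfold quadCode
  fun_prop

end QuadForm

@[fun_prop]
theorem primrec_polyCode {p : σ → List (List RatCode)} {i j : σ → ℕ} (hp : Primrec p)
    (hi : Primrec i) (hj : Primrec j) : Primrec fun s => polyCode (p s) (i s) (j s) := by
  unfold polyCode
  fun_prop

@[fun_prop]
theorem primrec_powCode {r : σ → RatCode} {N i : σ → ℕ} (hr : Primrec r) (hN : Primrec N)
    (hi : Primrec i) : Primrec fun s => powCode (r s) (N s) (i s) := by
  unfold powCode
  fun_prop

namespace ShiftFactor

@[fun_prop]
theorem primrec_mk {x : σ → RatCode} {b c : σ → Bool} {l : σ → LinForm} (hx : Primrec x)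
    (hb : Primrec b) (hl : Primrec l) (hc : Primrec c) :
    Primrec fun s => (⟨x s, b s, l s, c s⟩ : ShiftFactor) :=
  (Primrec.of_equiv_symm (e := equiv)).comp (hx.pair (hb.pair (hl.pair hc)))

variable {f : σ → ShiftFactor} (hf : Primrec f)
include hf

theorem primrec_equiv : Primrec fun s => equiv (f s) := Primrec.of_equiv.comp hf

@[fun_prop]
theorem primrec_x : Primrec fun s => (f s).x := Primrec.fst.comp (primrec_equiv hf)

@[fun_prop]
theorem primrec_perturbed : Primrec fun s => (f s).perturbed :=
  Primrec.fst.comp (Primrec.snd.comp (primrec_equiv hf))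

@[fun_prop]
theorem primrec_form : Primrec fun s => (f s).form :=
  Primrec.fst.comp (Primrec.snd.comp (Primrec.snd.comp (primrec_equiv hf)))

@[fun_prop]
theorem primrec_inverse : Primrec fun s => (f s).inverse :=
  Primrec.snd.comp (Primrec.snd.comp (Primrec.snd.comp (primrec_equiv hf)))

@[fun_prop]
theorem primrec_ratioCode {t : σ → ℤ} (ht : Primrec t) :
    Primrec fun s => (f s).ratioCode (t s) := by
  unfold ratioCode exponent
  fun_prop

@[fun_prop]
theorem primrec_code {N i j : σ → ℕ} (hN : Primrec N) (hi : Primrec i) (hj : Primrec j) :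
    Primrec fun s => (f s).code (N s) (i s) (j s) := by
  unfold code offset range
  fun_prop

end ShiftFactor

section QFactor

variable {f : σ → QFactor} (hf : Primrec f)
include hf

theorem primrec_qFactor_equiv : Primrec fun s => QFactor.equiv (f s) := Primrec.of_equiv.comp hf

@[fun_prop]
theorem primrec_qFactor_x : Primrec fun s => (f s).x := Primrec.fst.comp (primrec_qFactor_equiv hf)

@[fun_prop]
theorem primrec_qFactor_s : Primrec fun s => (f s).s :=
  Primrec.fst.comp (Primrec.snd.comp (primrec_qFactor_equiv hf))

@[fun_prop]
theorem primrec_qFactor_m : Primrec fun s => (f s).m :=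
  Primrec.snd.comp (Primrec.snd.comp (primrec_qFactor_equiv hf))

@[fun_prop]
theorem primrec_shiftFactors : Primrec fun s => (f s).shiftFactors := by
  unfold QFactor.shiftFactors
  fun_prop

@[fun_prop]
theorem primrec_invShiftFactors : Primrec fun s => (f s).invShiftFactors := by
  unfold QFactor.invShiftFactors
  fun_prop

end QFactor

@[fun_prop]
theorem primrec_shiftCode {T : σ → TermCode} {N i j : σ → ℕ} (hT : Primrec T) (hN : Primrec N)
    (hi : Primrec i) (hj : Primrec j) : Primrec fun s => (T s).shiftCode (N s) (i s) (j s) := by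
  have h : Primrec fun s => TermCode.equiv (T s) := Primrec.of_equiv.comp hT
  have hpoly : Primrec fun s => (T s).poly := Primrec.fst.comp h
  have hξ : Primrec fun s => (T s).ξ := Primrec.fst.comp (Primrec.snd.comp h)
  have hη : Primrec fun s => (T s).η := Primrec.fst.comp (Primrec.snd.comp (Primrec.snd.comp h))
  have h := Primrec.snd.comp (Primrec.snd.comp (Primrec.snd.comp h))
  have hquad : Primrec fun s => (T s).quad := Primrec.fst.comp h
  have hnum : Primrec fun s => (T s).num := Primrec.fst.comp (Primrec.snd.comp h)
  have hden : Primrec fun s => (T s).den := Primrec.snd.comp (Primrec.snd.comp h)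
  unfold TermCode.shiftCode TermCode.shiftFactors
  fun_prop

section EqCode

variable {P : σ → EqCode} {i : σ → ℕ} (hP : Primrec P) (hi : Primrec i)
include hP hi

@[fun_prop]
theorem primrec_eqCode_num : Primrec fun s => (P s).num (i s) := by
  unfold EqCode.num
  fun_prop

@[fun_prop]
theorem primrec_eqCode_den : Primrec fun s => (P s).den (i s) := by
  unfold EqCode.den
  fun_prop

@[fun_prop]
theorem primrec_coeffCode {x : σ → LaurentCode} (hx : Primrec x) :
    Primrec fun s => (P s).coeffCode (x s) (i s) := by
  unfold EqCode.coeffCode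
  fun_prop

end EqCode

namespace Certificate

variable {P : σ → EqCode} {T : σ → TermCode} {c : σ → Certificate} {i j : σ → ℕ}
  (hP : Primrec P) (hT : Primrec T) (hc : Primrec c) (hi : Primrec i) (hj : Primrec j)

section

include hc

theorem primrec_equiv : Primrec fun s => equiv (c s) := Primrec.of_equiv.comp hc

@[fun_prop]
theorem primrec_order : Primrec fun s => (c s).order := Primrec.fst.comp (primrec_equiv hc)

@[fun_prop]
theorem primrec_weight : Primrec fun s => (c s).weight :=
  Primrec.fst.comp (Primrec.snd.comp (primrec_equiv hc))

include hi

@[fun_prop]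
theorem primrec_α (hj : Primrec j) : Primrec fun s => (c s).α (i s) (j s) := by
  have : Primrec fun s => (c s).recurrence := Primrec.fst.comp <| Primrec.snd.comp <|
    Primrec.snd.comp <| Primrec.snd.comp <| primrec_equiv hc
  unfold α
  fun_prop

@[fun_prop]
theorem primrec_β : Primrec fun s => (c s).β (i s) := by
  have : Primrec fun s => (c s).cofactors := Primrec.fst.comp <| Primrec.snd.comp <|
    Primrec.snd.comp <| Primrec.snd.comp <| Primrec.snd.comp <| primrec_equiv hc
  unfold β
  fun_prop

@[fun_prop]
theorem primrec_A : Primrec fun s => (c s).A (i s) := by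
  have : Primrec fun s => (c s).result := Primrec.fst.comp <| Primrec.snd.comp <|
    Primrec.snd.comp <| Primrec.snd.comp <| Primrec.snd.comp <| Primrec.snd.comp <|
    primrec_equiv hc
  unfold A
  fun_prop

@[fun_prop]
theorem primrec_sumRelation : Primrec fun s => (c s).sumRelation (i s) := by
  have hmultiplicity : Primrec fun s => (c s).multiplicity := Primrec.fst.comp <|
    Primrec.snd.comp <| Primrec.snd.comp <| primrec_equiv hc
  have hB : Primrec fun s => (c s).B (i s) := by
    have : Primrec fun s => (c s).remainders := Primrec.snd.comp <| Primrec.snd.comp <|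
      Primrec.snd.comp <| Primrec.snd.comp <| Primrec.snd.comp <| Primrec.snd.comp <|
      primrec_equiv hc
    unfold B
    fun_prop
  unfold sumRelation
  fun_prop

end

include hc

@[fun_prop]
theorem primrec_output : Primrec fun s => (c s).output := by
  unfold output
  fun_prop

include hP hT

@[fun_prop]
theorem primrec_termRelation (hj : Primrec j) :
    Primrec fun s => (c s).termRelation (P s) (T s) (j s) := by
  unfold termRelation
  fun_prop

@[fun_prop]
theorem primrecPred_isValid : PrimrecPred fun s => (c s).IsValid (P s) (T s) := by
  unfold IsValid
  fun_prop

end Certificate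

end Primrec

theorem partrec_certSearch : Partrec certSearch := by
  refine Partrec.rfindOpt (Primrec₂.to_comp ?_)
  refine Primrec.option_bind (Primrec.decode.comp Primrec.snd) ?_
  change Primrec fun p : ((EqCode × TermCode) × ℕ) × Certificate =>
    if p.2.IsValid p.1.1.1 p.1.1.2 then some p.2.output else none
  exact Primrec.ite (by fun_prop) (Primrec.option_some.comp (by fun_prop)) (Primrec.const none)

/-! ### Polynomials given by lists of coefficients -/

section CoeffEval

variable {R S : Type*} [Semiring R] [Semiring S]

@[simp]
theorem coeffEval_nil (x : R) : coeffEval x [] = 0 := rfl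

@[simp]
theorem coeffEval_cons (x c : R) (l : List R) : coeffEval x (c :: l) = c + x * coeffEval x l := rfl

theorem map_coeffEval (f : R →+* S) (x : R) (l : List R) :
    f (coeffEval x l) = coeffEval (f x) (l.map f) := by
  induction l <;> simp [*]

theorem coeff_coeffEval_X (l : List R) (n : ℕ) :
    (coeffEval Polynomial.X (l.map Polynomial.C)).coeff n = l.getD n 0 := by
  induction l generalizing n with
  | nil => simp
  | cons c l ih => cases n <;> simp_all [Polynomial.coeff_C]

theorem coeffEval_X_eq_zero_iff (l : List R) :
    coeffEval Polynomial.X (l.map Polynomial.C) = 0 ↔ ∀ c ∈ l, c = 0 := by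
  simp_rw [Polynomial.ext_iff, coeff_coeffEval_X, Polynomial.coeff_zero]
  refine ⟨fun h c hc => ?_, fun h n => ?_⟩
  · obtain ⟨n, hn, rfl⟩ := List.getElem_of_mem hc
    rw [← h n, List.getD_eq_getElem]
  · obtain hn | hn := lt_or_ge n l.length
    · rw [List.getD_eq_getElem _ _ hn, h _ (List.getElem_mem hn)]
    · exact List.getD_eq_default _ _ hn

theorem exists_coeffEval_X_eq (p : Polynomial R) :
    ∃ l : List R, coeffEval Polynomial.X (l.map Polynomial.C) = p := by
  refine ⟨(List.range (p.natDegree + 1)).map p.coeff, Polynomial.ext fun n => ?_⟩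
  rw [coeff_coeffEval_X]
  obtain hn | hn := lt_or_ge n (p.natDegree + 1)
  · simp [hn]
  · rw [List.getD_eq_default _ _ (by simpa using hn), Polynomial.coeff_eq_zero_of_natDegree_lt hn]

end CoeffEval

theorem intPoly_eq_coeffEval (l : List ℤ) :
    intPoly l = coeffEval q (l.map (Int.cast : ℤ → Kq)) := by
  unfold intPoly
  congr 1
  induction l with
  | nil => rfl
  | cons c l ih => simpa using ih

theorem intPoly_eq_algebraMap (l : List ℤ) : intPoly l = algebraMap (Polynomial ℚ) Kq
    (coeffEval Polynomial.X ((l.map (Int.cast : ℤ → ℚ)).map Polynomial.C)) := by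
  simp [intPoly_eq_coeffEval, q, map_coeffEval, Function.comp_def]

theorem intPoly_eq_zero_iff (l : List ℤ) : intPoly l = 0 ↔ AllZero l := by
  rw [intPoly_eq_algebraMap, map_eq_zero_iff _ (RatFunc.algebraMap_injective ℚ),
    coeffEval_X_eq_zero_iff]
  simp [AllZero]

namespace RatCode

theorem intPoly_den_ne_zero (r : RatCode) : intPoly r.den ≠ 0 := by
  unfold den
  split_ifs with h
  · simp [intPoly]
  · rwa [Ne, intPoly_eq_zero_iff]

theorem intPoly_num_div_intPoly_den (r : RatCode) : intPoly r.num / intPoly r.den = r.val := by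
  unfold num den
  split_ifs with h
  · rw [val, (intPoly_eq_zero_iff r.2).2 h, (intPoly_eq_zero_iff []).2 (List.forall_mem_nil _),
      zero_div, div_zero]
  · rfl

end RatCode

theorem q_ne_zero : q ≠ 0 := RatFunc.X_ne_zero

theorem q_pow_injective : Function.Injective fun n : ℕ => q ^ n := by
  intro m n h
  have : (Polynomial.X ^ m : Polynomial ℚ) = Polynomial.X ^ n := by
    apply RatFunc.algebraMap_injective
    simpa [q] using h
  simpa using congrArg Polynomial.natDegree this

theorem q_zpow_ne_one {n : ℤ} (hn : n ≠ 0) : q ^ n ≠ 1 := by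
  have eq_zero (m : ℕ) (h : q ^ m = 1) : m = 0 := q_pow_injective (h.trans (pow_zero q).symm)
  obtain ⟨m, rfl | rfl⟩ := Int.eq_nat_or_neg n <;> simpa using mt (eq_zero m) (by simpa using hn)

/-! ### Values of codes -/

@[to_additive]
theorem prod_map_range {M : Type*} [CommMonoid M] (f : ℕ → M) (n : ℕ) :
    ((List.range n).map f).prod = ∏ i ∈ Finset.range n, f i := rfl

section FracHorner

variable {G F : Type*} [AddCommMonoid G] [Field F] (x : GroupRingCode G)
  (l : List (GroupRingCode G × GroupRingCode G))

theorem fracHorner_snd : (fracHorner x l).2 = (l.map Prod.snd).prod := by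
  induction l with
  | nil => rfl
  | cons c l ih => rw [List.map_cons, List.prod_cons, ← ih]; rfl

theorem map_fracHorner_snd_ne_zero (φ : AddMonoidAlgebra ℤ G →+* F)
    (h : ∀ c ∈ l, φ c.2.val ≠ 0) : φ (fracHorner x l).2.val ≠ 0 := by
  simpa [fracHorner_snd, map_list_prod, List.prod_eq_zero_iff] using h

theorem map_fracHorner (φ : AddMonoidAlgebra ℤ G →+* F) (h : ∀ c ∈ l, φ c.2.val ≠ 0) :
    φ (fracHorner x l).1.val / φ (fracHorner x l).2.val =
      coeffEval (φ x.val) (l.map fun c => φ c.1.val / φ c.2.val) := by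
  induction l with
  | nil => simp [fracHorner]
  | cons c l ih =>
    have hc : φ c.2.val ≠ 0 := h c List.mem_cons_self
    have hl : ∀ c ∈ l, φ c.2.val ≠ 0 := fun c hc => h c (List.mem_cons_of_mem _ hc)
    have hden := map_fracHorner_snd_ne_zero x l φ hl
    rw [List.map_cons, coeffEval_cons, ← ih hl]
    change φ (c.1 * (fracHorner x l).2 + x * ((fracHorner x l).1 * c.2)).val /
      φ (c.2 * (fracHorner x l).2).val = _
    simp only [val_add, val_mul, map_add, map_mul]
    field_simp

end FracHorner

section Evaluation

variable {F : Type*} [Field F] (κ : Kq →+* F) (z : Fˣ)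

/-- The evaluation of Laurent polynomials at `Q = q ^ n`, `K = q ^ k`, in a field in which `z` is
given. -/
noncomputable def ev (n k : ℤ) : AddMonoidAlgebra ℤ (ℤ × ℤ × ℤ × ℤ) →+* F :=
  (AddMonoidAlgebra.lift ℤ F (ℤ × ℤ × ℤ × ℤ)
    { toFun m := κ q ^ (m.toAdd.2.1 + n * m.toAdd.2.2.2 + k * m.toAdd.1) * (z : F) ^ m.toAdd.2.2.1
      map_one' := by simp
      map_mul' m m' := by
        have hq : κ q ≠ 0 := (map_ne_zero κ).2 q_ne_zero
        simp only [toAdd_mul, Prod.fst_add, Prod.snd_add, mul_add, zpow_add₀ hq,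
          zpow_add₀ z.ne_zero]
        ring }).toRingHom

@[simp]
theorem ev_single (n k d a b c : ℤ) : ev κ z n k (AddMonoidAlgebra.single (d, a, b, c) 1) =
    κ q ^ (a + n * c + k * d) * (z : F) ^ b := by
  simp [ev, AddMonoidAlgebra.lift_single]

/-- The evaluation of Laurent polynomials at `Q = q ^ n`. -/
noncomputable def coeffEv (n : ℤ) : AddMonoidAlgebra ℤ (ℤ × ℤ × ℤ) →+* F :=
  (ev κ z n 0).comp (AddMonoidAlgebra.mapDomainRingHom ℤ (AddMonoidHom.inr ℤ (ℤ × ℤ × ℤ)))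

@[simp]
theorem coeffEv_single (n a b c : ℤ) :
    coeffEv κ z n (AddMonoidAlgebra.single (a, b, c) 1) = κ q ^ (a + n * c) * (z : F) ^ b := by
  simp [coeffEv]

theorem ev_mapDomain_inr (n k : ℤ) (r : AddMonoidAlgebra ℤ (ℤ × ℤ × ℤ)) :
    ev κ z n k (AddMonoidAlgebra.mapDomainRingHom ℤ (AddMonoidHom.inr ℤ (ℤ × ℤ × ℤ)) r) =
      coeffEv κ z n r := by
  refine RingHom.congr_fun (f := (ev κ z n k).comp _) (AddMonoidAlgebra.ringHom_ext ?_ ?_) r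
  · intro c
    rw [← Int.cast_id (n := c), ← AddMonoidAlgebra.intCast_def, map_intCast, map_intCast]
  · rintro ⟨a, b, c⟩
    simp

variable {κ}

theorem map_intCode {G : Type*} [AddCommMonoid G] {φ : AddMonoidAlgebra ℤ G →+* F}
    {x : GroupRingCode G} (hx : φ x.val = κ q) (l : List ℤ) :
    φ (intCode x l).val = κ (intPoly l) := by
  simp [intCode, val_horner, map_coeffEval, intPoly_eq_coeffEval, hx, Function.comp_def]

theorem map_intCode₂ {G : Type*} [AddCommMonoid G] {φ : AddMonoidAlgebra ℤ G →+* F}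
    {x y : GroupRingCode G} (hx : φ x.val = κ q) (l : List (List ℤ)) :
    φ (intCode₂ x y l).val = coeffEval (φ y.val) (l.map fun m => κ (intPoly m)) := by
  simp [intCode₂, val_horner, map_coeffEval, map_intCode hx, Function.comp_def]

variable (κ)

@[simp]
theorem ev_qCode (n k : ℤ) : ev κ z n k qCode.val = κ q := by simp [qCode]

@[simp]
theorem ev_intCode (n k : ℤ) (l : List ℤ) :
    ev κ z n k (intCode qCode l).val = κ (intPoly l) :=
  map_intCode (ev_qCode κ z n k) l

theorem map_den_ne_zero (r : RatCode) : κ (intPoly r.den) ≠ 0 :=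
  (map_ne_zero κ).2 r.intPoly_den_ne_zero

theorem map_num_div_map_den (r : RatCode) : κ (intPoly r.num) / κ (intPoly r.den) = κ r.val := by
  rw [← map_div₀, r.intPoly_num_div_intPoly_den]

end Evaluation

/-! ### Quantum factorials -/

section QPoch

variable {F : Type*} [Field F] {q y : F}

/-- The quantum factorial in an arbitrary field. -/
noncomputable def qPoch (q y : F) : ℤ → F
  | Int.ofNat m => ∏ i ∈ Finset.range m, (1 - y * q ^ i)
  | Int.negSucc m => (∏ i ∈ Finset.range (m + 1), (1 - y * q ^ (-((i : ℤ) + 1))))⁻¹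

theorem qPoch_zero (q y : F) : qPoch q y 0 = 1 := Finset.prod_range_zero _

theorem qPoch_natCast_succ (q y : F) (m : ℕ) :
    qPoch q y ((m : ℤ) + 1) = (1 - y * q ^ (m : ℤ)) * qPoch q y m := by
  rw [mul_comm, zpow_natCast]
  exact Finset.prod_range_succ _ m

theorem inv_qPoch_negSucc (q y : F) (m : ℕ) : (qPoch q y (Int.negSucc m))⁻¹ =
    (1 - y * q ^ Int.negSucc m) * (qPoch q y (Int.negSucc m + 1))⁻¹ := by
  have hprev : (qPoch q y (Int.negSucc m + 1))⁻¹ =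
      ∏ i ∈ Finset.range m, (1 - y * q ^ (-((i : ℤ) + 1))) := by
    cases m with
    | zero => exact (congrArg _ (qPoch_zero q y)).trans (by simp)
    | succ m => exact inv_inv _
  rw [hprev, mul_comm, Int.negSucc_eq, ← Finset.prod_range_succ, ← Int.negSucc_eq]
  exact inv_inv _

theorem qPoch_succ {s : ℤ} (h : s < 0 → 1 - y * q ^ s ≠ 0) :
    qPoch q y (s + 1) = (1 - y * q ^ s) * qPoch q y s := by
  match s with
  | Int.ofNat m => exact qPoch_natCast_succ q y m
  | Int.negSucc m =>
    rw [← inv_inj, mul_inv, inv_qPoch_negSucc, inv_mul_cancel_left₀ (h (Int.negSucc_lt_zero m))]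

theorem inv_qPoch {s : ℤ} (h : 0 ≤ s → 1 - y * q ^ s ≠ 0) :
    (qPoch q y s)⁻¹ = (1 - y * q ^ s) * (qPoch q y (s + 1))⁻¹ := by
  match s with
  | Int.ofNat m =>
    have hm : 1 - y * q ^ (m : ℤ) ≠ 0 := h (Int.natCast_nonneg m)
    rw [Int.ofNat_eq_natCast, qPoch_natCast_succ, mul_inv, mul_inv_cancel_left₀ hm]
  | Int.negSucc m => exact inv_qPoch_negSucc q y m

theorem qPoch_ne_zero (hy : ∀ s : ℤ, 1 - y * q ^ s ≠ 0) (s : ℤ) : qPoch q y s ≠ 0 := by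
  cases s with
  | ofNat m => exact Finset.prod_ne_zero_iff.2 fun i _ => by simpa using hy i
  | negSucc m => exact inv_ne_zero (Finset.prod_ne_zero_iff.2 fun i _ => hy _)

theorem qPoch_mul_zpow (hq : q ≠ 0) (hy : ∀ s : ℤ, 1 - y * q ^ s ≠ 0) (s m : ℤ) :
    qPoch q (y * q ^ s) m = qPoch q y (s + m) * (qPoch q y s)⁻¹ := by
  have hshift (t : ℤ) : 1 - y * q ^ s * q ^ t = 1 - y * q ^ (s + t) := by
    rw [mul_assoc, ← zpow_add₀ hq]
  have hsucc (t : ℤ) : qPoch q (y * q ^ s) (t + 1) =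
      (1 - y * q ^ (s + t)) * qPoch q (y * q ^ s) t := by
    rw [qPoch_succ fun _ => hshift t ▸ hy _, hshift]
  have hsucc' (t : ℤ) : qPoch q y (s + (t + 1)) = (1 - y * q ^ (s + t)) * qPoch q y (s + t) := by
    rw [← add_assoc, qPoch_succ fun _ => hy _]
  induction m using Int.induction_on with
  | zero => rw [qPoch_zero, add_zero, mul_inv_cancel₀ (qPoch_ne_zero hy s)]
  | succ m ih => rw [hsucc, ih, hsucc', mul_assoc]
  | pred m ih =>
    have h1 := hsucc (-m - 1)
    have h2 := hsucc' (-m - 1)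
    rw [sub_add_cancel] at h1 h2
    rw [h1, h2, mul_assoc] at ih
    exact mul_left_cancel₀ (hy _) ih

end QPoch

/-! ### The perturbed term -/

section Term

variable {F : Type*} [Field F] (κ : Kq →+* F) (z : Fˣ)

/-- The values of `G` at the points `(n + i, k + j)`, `i, j ≤ N`, are proportional to those of the
codes `c i j` at `(n, k)`. -/
def IsShiftCode (N : ℕ) (c : ℕ → ℕ → LaurentCode) (G : ℤ → ℤ → F) : Prop :=
  ∀ n k : ℤ, ∃ b : F, ∀ i ≤ N, ∀ j ≤ N, G (n + i) (k + j) = ev κ z n k (c i j).val * b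

variable {κ z} {N : ℕ}

theorem IsShiftCode.mul {c c' : ℕ → ℕ → LaurentCode} {G G' : ℤ → ℤ → F}
    (h : IsShiftCode κ z N c G) (h' : IsShiftCode κ z N c' G') :
    IsShiftCode κ z N (fun i j => c i j * c' i j) fun n k => G n k * G' n k := fun n k => by
  obtain ⟨b, hb⟩ := h n k
  obtain ⟨b', hb'⟩ := h' n k
  refine ⟨b * b', fun i hi j hj => ?_⟩
  beta_reduce
  rw [hb i hi j hj, hb' i hi j hj, val_mul, map_mul, mul_mul_mul_comm]

theorem IsShiftCode.list_prod {ι : Type*} {c : ι → ℕ → ℕ → LaurentCode} {G : ι → ℤ → ℤ → F}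
    {l : List ι} (h : ∀ x ∈ l, IsShiftCode κ z N (c x) (G x)) :
    IsShiftCode κ z N (fun i j => (l.map fun x => c x i j).prod)
      fun n k => (l.map fun x => G x n k).prod := by
  induction l with
  | nil => exact fun n k => ⟨1, by simp⟩
  | cons x l ih =>
    simp only [List.map_cons, List.prod_cons]
    exact (h x List.mem_cons_self).mul (ih fun y hy => h y (List.mem_cons_of_mem x hy))

variable (κ z)

/-- The value of a polynomial `∑ i j, p_{ji} Q ^ i K ^ j` at `Q = q ^ n`, `K = q ^ k`. -/
noncomputable def polyVal (p : List (List RatCode)) (n k : ℤ) : F :=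
  coeffEval (κ q ^ k) (p.map fun l => coeffEval (κ q ^ n) (l.map fun r => κ r.val))

theorem polyVal_natCast (p : List (List RatCode)) (n k : ℕ) : polyVal κ p n k =
    κ (coeffEval (q ^ k) (p.map fun l => coeffEval (q ^ n) (l.map RatCode.val))) := by
  simp [polyVal, map_coeffEval, Function.comp_def]

theorem ev_polyCode (p : List (List RatCode)) (n k : ℤ) (i j : ℕ) :
    ev κ z n k (polyCode p i j).2.val ≠ 0 ∧
      ev κ z n k (polyCode p i j).1.val / ev κ z n k (polyCode p i j).2.val =
        polyVal κ p (n + i) (k + j) := by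
  let row (l : List RatCode) : LaurentCode × LaurentCode :=
    fracHorner (single (0, i, 0, 1)) (l.map fun r => (intCode qCode r.num, intCode qCode r.den))
  have hcoeff (l : List RatCode) : ∀ c ∈ l.map fun r => (intCode qCode r.num, intCode qCode r.den),
      ev κ z n k c.2.val ≠ 0 := by
    simp only [List.forall_mem_map, ev_intCode]
    exact fun r _ => map_den_ne_zero κ r
  have hrow : ∀ c ∈ p.map row, ev κ z n k c.2.val ≠ 0 :=
    List.forall_mem_map.2 fun l _ => map_fracHorner_snd_ne_zero _ _ _ (hcoeff l)
  have hrow_div (l : List RatCode) : ev κ z n k (row l).1.val / ev κ z n k (row l).2.val =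
      coeffEval (κ q ^ (n + i)) (l.map fun r => κ r.val) := by
    rw [map_fracHorner _ _ _ (hcoeff l)]
    simp [Function.comp_def, map_num_div_map_den, add_comm n]
  refine ⟨map_fracHorner_snd_ne_zero _ _ _ hrow, (map_fracHorner _ _ _ hrow).trans ?_⟩
  simp [Function.comp_def, hrow_div, polyVal, add_comm k]

theorem polyCode_snd (p : List (List RatCode)) (i j : ℕ) :
    (polyCode p i j).2 = (polyCode p 0 0).2 := by
  simp [polyCode, fracHorner_snd, Function.comp_def]

theorem isShiftCode_polyCode (p : List (List RatCode)) :
    IsShiftCode κ z N (fun i j => (polyCode p i j).1) (polyVal κ p) := fun n k =>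
  ⟨(ev κ z n k (polyCode p 0 0).2.val)⁻¹, fun i _ j _ => by
    rw [← (ev_polyCode κ z p n k i j).2, polyCode_snd p i j, div_eq_mul_inv]⟩

theorem intPoly_snd_ne_zero {r : RatCode} (h : r.val ≠ 0) : intPoly r.2 ≠ 0 := fun h' =>
  h (by rw [RatCode.val, h', div_zero])

theorem ev_powCode {r : RatCode} (hr : r.val ≠ 0) (n k m : ℤ) {i : ℕ} (hi : i ≤ N) :
    κ r.val ^ (m + i) =
      ev κ z n k (powCode r N i).val * (κ r.val ^ m / κ (intPoly r.2) ^ N) := by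
  have hval : κ r.val ≠ 0 := (map_ne_zero κ).2 hr
  have hden : κ (intPoly r.2) ≠ 0 := (map_ne_zero κ).2 (intPoly_snd_ne_zero hr)
  have hnum : κ (intPoly r.1) = κ r.val * κ (intPoly r.2) := by
    rw [RatCode.val, map_div₀, div_mul_cancel₀ _ hden]
  simp only [powCode, val_mul, val_pow, map_mul, map_pow, ev_intCode]
  rw [hnum, mul_pow, mul_assoc (κ r.val ^ i), ← pow_add, Nat.add_sub_of_le hi, zpow_add₀ hval,
    zpow_natCast]
  field_simp

theorem isShiftCode_powCode_left {r : RatCode} (hr : r.val ≠ 0) :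
    IsShiftCode κ z N (fun i _ => powCode r N i) fun n _ => κ r.val ^ n := fun n k =>
  ⟨_, fun _ hi _ _ => ev_powCode κ z hr n k n hi⟩

theorem isShiftCode_powCode_right {r : RatCode} (hr : r.val ≠ 0) :
    IsShiftCode κ z N (fun _ j => powCode r N j) fun _ k => κ r.val ^ k := fun n k =>
  ⟨_, fun _ _ _ hj => ev_powCode κ z hr n k k hj⟩

namespace LinForm

/-- The extension of `LinForm.val` to integers. -/
def eval (l : LinForm) (n k : ℤ) : ℤ := l.a * n + l.b * k + l.c

@[simp]
theorem eval_natCast (l : LinForm) (n k : ℕ) : l.eval n k = l.val n k := rfl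

@[simp]
theorem eval_shift (l : LinForm) (t n k : ℤ) : (l.shift t).eval n k = l.eval n k + t := by
  simp only [eval, shift]
  ring

@[simp]
theorem eval_add (l m : LinForm) (n k : ℤ) : (l + m).eval n k = l.eval n k + m.eval n k := by
  change (l.a + m.a) * n + (l.b + m.b) * k + (l.c + m.c) = _
  simp only [eval]
  ring

@[simp]
theorem eval_neg (l : LinForm) (n k : ℤ) : (-l).eval n k = -l.eval n k := by
  change -l.a * n + -l.b * k + -l.c = _
  simp only [eval]
  ring

end LinForm

/-- The extension of `QuadForm.val` to integers. -/
def QuadForm.eval (e : QuadForm) (n k : ℤ) : ℤ :=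
  e.nn * (n * (n - 1) / 2) + e.nk * (n * k) + e.kk * (k * (k - 1) / 2) + e.lin.eval n k

theorem triangle_add (n m : ℤ) :
    (n + m) * (n + m - 1) / 2 = n * (n - 1) / 2 + m * (m - 1) / 2 + n * m := by
  obtain ⟨a, ha⟩ := (Int.even_mul_pred_self n).two_dvd
  obtain ⟨b, hb⟩ := (Int.even_mul_pred_self m).two_dvd
  have : (n + m) * (n + m - 1) = 2 * (a + b + n * m) := by linear_combination ha + hb
  rw [this, ha, hb]
  simp

theorem natCast_triangle (i : ℕ) : ((i * (i - 1) / 2 : ℕ) : ℤ) = (i : ℤ) * ((i : ℤ) - 1) / 2 := by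
  cases i <;> simp

theorem QuadForm.eval_natCast (e : QuadForm) (n k : ℕ) : e.eval n k = e.val n k := by
  rw [eval, val, LinForm.eval_natCast, Nat.choose_two_right, Nat.choose_two_right,
    natCast_triangle, natCast_triangle]

theorem isShiftCode_quadCode (e : QuadForm) :
    IsShiftCode κ z N (quadCode e) fun n k => κ q ^ e.eval n k := fun n k =>
  ⟨κ q ^ e.eval n k, fun i _ j _ => by
    rw [quadCode, val_single, ev_single, zpow_zero, mul_one,
      ← zpow_add₀ ((map_ne_zero κ).2 q_ne_zero)]
    refine congrArg (κ q ^ ·) ?_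
    simp only [natCast_triangle, QuadForm.eval, triangle_add, LinForm.eval]
    push_cast
    ring⟩

namespace ShiftFactor

variable (f : ShiftFactor)

/-- The parameter `y` of the quantum factorial. -/
noncomputable def param : F := κ f.x.val * bif f.perturbed then (z : F) else 1

/-- The function `G` in the description of `ShiftFactor`. -/
noncomputable def fn (s : ℤ) : F :=
  bif f.inverse then (qPoch (κ q) (f.param κ z) (-s))⁻¹ else qPoch (κ q) (f.param κ z) s

/-- No factor in the denominator of `G` vanishes. -/
def IsRegular : Prop :=
  ∀ s : ℤ, (if f.inverse then 0 ≤ s else s < 0) → 1 - f.param κ z * κ q ^ s ≠ 0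

/-- The exponent `e` of `q` in the recurrence `G (s + 1) = (1 - y q ^ e) G s`. -/
def stepExponent (s : ℤ) : ℤ := bif f.inverse then -s - 1 else s

theorem IsRegular.fn_succ {f : ShiftFactor} (hf : f.IsRegular κ z) (s : ℤ) :
    f.fn κ z (s + 1) = (1 - f.param κ z * κ q ^ f.stepExponent s) * f.fn κ z s := by
  unfold IsRegular at hf
  unfold fn stepExponent
  cases h : f.inverse with
  | true =>
    have hinv := inv_qPoch (hf (-s - 1) ∘ (if_pos h).mpr)
    simpa only [cond_true, sub_add_cancel, neg_add'] using hinv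
  | false => exact qPoch_succ (hf s ∘ (if_neg (by simp [h])).mpr)

theorem eval_exponent (n k t : ℤ) :
    (f.exponent t).eval n k = f.stepExponent (f.form.eval n k + t) := by
  unfold exponent stepExponent
  cases f.inverse
  · simp
  · simp only [cond_true, LinForm.eval_shift, LinForm.eval_neg]
    ring

theorem ev_ratioCode (n k t : ℤ) : ev κ z n k (f.ratioCode t).val =
    κ (intPoly f.x.den) *
      (1 - f.param κ z * κ q ^ f.stepExponent (f.form.eval n k + t)) := by
  have hden : κ (intPoly f.x.den) ≠ 0 := map_den_ne_zero κ f.x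
  have heval : (f.exponent t).c + n * (f.exponent t).a + k * (f.exponent t).b =
      f.stepExponent (f.form.eval n k + t) := by
    rw [← eval_exponent, LinForm.eval]
    ring
  rw [ratioCode, param, ← map_num_div_map_den]
  simp only [val_sub, val_mul, val_single, map_sub, map_mul, ev_intCode, ev_single, heval]
  cases f.perturbed
  · simp only [cond_false, zpow_zero]
    field_simp
  · simp only [cond_true, zpow_one]
    field_simp

variable {N : ℕ}

theorem abs_form_le {i j : ℕ} (hi : i ≤ N) (hj : j ≤ N) :
    |f.form.a * i + f.form.b * j| ≤ f.range N := by
  refine (abs_add_le _ _).trans ?_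
  rw [range, abs_mul, abs_mul, Nat.abs_cast, Nat.abs_cast]
  push_cast
  rw [add_mul]
  gcongr

theorem natCast_offset {i j : ℕ} (hi : i ≤ N) (hj : j ≤ N) :
    (f.offset N i j : ℤ) = f.form.a * i + f.form.b * j + f.range N := by
  have := (abs_le.1 (f.abs_form_le hi hj)).1
  exact Int.toNat_of_nonneg (by omega)

theorem offset_le {i j : ℕ} (hi : i ≤ N) (hj : j ≤ N) : f.offset N i j ≤ 2 * f.range N := by
  have := (abs_le.1 (f.abs_form_le hi hj)).2
  have := f.natCast_offset hi hj
  omega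

theorem eq_prod_mul_of_succ {f G : ℤ → F} (h : ∀ s, G (s + 1) = f s * G s) (s : ℤ) (r : ℕ) :
    G (s + r) = (∏ t ∈ Finset.range r, f (s + t)) * G s := by
  induction r with
  | zero => simp
  | succ r ih => rw [Finset.prod_range_succ_comm, Nat.cast_succ, ← add_assoc, h, ih, mul_assoc]

theorem IsRegular.isShiftCode {f : ShiftFactor} (hf : f.IsRegular κ z) :
    IsShiftCode κ z N (f.code N) fun n k => f.fn κ z (f.form.eval n k) := fun n k => by
  have hden : κ (intPoly f.x.den) ≠ 0 := map_den_ne_zero κ f.x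
  refine ⟨f.fn κ z (f.form.eval n k - f.range N) / κ (intPoly f.x.den) ^ (2 * f.range N),
    fun i hi j hj => ?_⟩
  have hform : f.form.eval (n + i) (k + j) =
      f.form.eval n k - f.range N + (f.offset N i j : ℤ) := by
    rw [f.natCast_offset hi hj, LinForm.eval, LinForm.eval]
    ring
  beta_reduce
  rw [hform, eq_prod_mul_of_succ (hf.fn_succ κ z), code]
  simp only [val_mul, val_list_prod, val_pow, map_mul, map_list_prod, map_pow, List.map_map,
    ev_intCode, Function.comp_def, ev_ratioCode]
  rw [prod_map_range, Finset.prod_mul_distrib, Finset.prod_const, Finset.card_range,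
    ← Nat.add_sub_of_le (f.offset_le hi hj), pow_add, Nat.add_sub_cancel_left]
  simp only [sub_add_eq_add_sub, add_sub_assoc]
  field_simp

end ShiftFactor

/-- The perturbed term, defined at all integers. -/
noncomputable def termFun (T : TermCode) (n k : ℤ) : F :=
  polyVal κ T.poly n k * κ T.ξ.val ^ n * κ T.η.val ^ k * κ q ^ T.quad.eval n k *
    (T.shiftFactors.map fun f => f.fn κ z (f.form.eval n k)).prod

theorem isShiftCode_shiftCode {T : TermCode} (hξ : T.ξ.val ≠ 0) (hη : T.η.val ≠ 0)
    (hreg : ∀ f ∈ T.shiftFactors, f.IsRegular κ z) :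
    IsShiftCode κ z N (T.shiftCode N) (termFun κ z T) :=
  ((((isShiftCode_polyCode κ z T.poly).mul (isShiftCode_powCode_left κ z hξ)).mul
    (isShiftCode_powCode_right κ z hη)).mul (isShiftCode_quadCode κ z T.quad)).mul
    (.list_prod fun f hf => (hreg f hf).isShiftCode)

end Term

/-! ### Clearing the denominators of an equation -/

/-- The polynomial with the given coefficients, so that `intPoly₂ l` is its image in `ℚ(q, Q)`. -/
noncomputable def poly₂ (l : List (List ℤ)) : Polynomial Kq :=
  coeffEval Polynomial.X ((l.map intPoly).map Polynomial.C)

theorem intPoly₂_eq_algebraMap (l : List (List ℤ)) :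
    intPoly₂ l = algebraMap (Polynomial Kq) KqQ (poly₂ l) := by
  simp [poly₂, map_coeffEval, intPoly₂, Function.comp_def]

theorem poly₂_eq_zero_iff (l : List (List ℤ)) : poly₂ l = 0 ↔ AllZero₂ l := by
  rw [poly₂, coeffEval_X_eq_zero_iff]
  simp [AllZero₂, intPoly_eq_zero_iff]

theorem intPoly₂_eq_zero_iff (l : List (List ℤ)) : intPoly₂ l = 0 ↔ AllZero₂ l := by
  rw [intPoly₂_eq_algebraMap, map_eq_zero_iff _ (RatFunc.algebraMap_injective Kq),
    poly₂_eq_zero_iff]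

theorem eval_poly₂ (x : Kq) (l : List (List ℤ)) :
    (poly₂ l).eval x = coeffEval x (l.map intPoly) := by
  rw [poly₂, ← Polynomial.coe_evalRingHom, map_coeffEval]
  simp [Function.comp_def]

theorem definedAt_div {a b : Polynomial Kq} {n : ℕ} (hb : b.eval (q ^ n) ≠ 0) :
    DefinedAt (algebraMap _ KqQ a / algebraMap _ KqQ b) n := fun h => by
  obtain ⟨c, hc⟩ := RatFunc.denom_div_dvd a b
  exact hb (by rw [hc, Polynomial.eval_mul, h, zero_mul])

theorem valueAt_div {a b : Polynomial Kq} {n : ℕ} (hb : b.eval (q ^ n) ≠ 0) :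
    valueAt (algebraMap _ KqQ a / algebraMap _ KqQ b) n = a.eval (q ^ n) / b.eval (q ^ n) := by
  have hb0 : b ≠ 0 := fun h => hb (by rw [h, Polynomial.eval_zero])
  have h := congrArg (Polynomial.eval (q ^ n)) ((RatFunc.num_mul_eq_mul_denom_iff
    (x := algebraMap _ KqQ a / algebraMap _ KqQ b) hb0).2 rfl)
  rw [Polynomial.eval_mul, Polynomial.eval_mul] at h
  rw [valueAt, RatFunc.eval, Polynomial.eval₂_id, Polynomial.eval₂_id,
    div_eq_div_iff (definedAt_div hb) hb, h]

/-- The extension of a sequence by zero to the negative integers. -/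
def extend {α : Type*} [Zero α] (J : ℕ → α) : ℤ → α
  | Int.ofNat n => J n
  | Int.negSucc _ => 0

@[simp]
theorem extend_natCast {α : Type*} [Zero α] (J : ℕ → α) (n : ℕ) : extend J n = J n := rfl

theorem extend_of_neg {α : Type*} [Zero α] (J : ℕ → α) {m : ℤ} (h : m < 0) : extend J m = 0 := by
  obtain ⟨n, rfl⟩ := Int.eq_negSucc_of_lt_zero h
  rfl

namespace EqCode

variable (P : EqCode)

theorem poly₂_den_ne_zero (i : ℕ) : poly₂ (P.den i) ≠ 0 := by
  unfold den
  split_ifs with h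
  · simp [poly₂, intPoly]
  · rwa [Ne, poly₂_eq_zero_iff]

theorem poly₂_num_eq_zero {i : ℕ} (h : P.length ≤ i) : poly₂ (P.num i) = 0 := by
  rw [num, List.getD_eq_default _ _ h]
  simp [poly₂]

theorem length_toEq : P.toEq.length = P.length := List.length_map _

theorem toEq_get {i : ℕ} (h : i < P.toEq.length) : P.toEq.get ⟨i, h⟩ =
    algebraMap _ KqQ (poly₂ (P.num i)) / algebraMap _ KqQ (poly₂ (P.den i)) := by
  have hget : P.toEq.get ⟨i, h⟩ =
      intPoly₂ (P.getD i ([], [[1]])).1 / intPoly₂ (P.getD i ([], [[1]])).2 := by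
    rw [List.getD_eq_getElem _ _ (P.length_toEq ▸ h)]
    simp [toEq]
  rw [hget, ← intPoly₂_eq_algebraMap, ← intPoly₂_eq_algebraMap, num, den]
  split_ifs with hzero
  · rw [(intPoly₂_eq_zero_iff _).2 hzero, (intPoly₂_eq_zero_iff []).2 (List.forall_mem_nil _),
      zero_div, div_zero]
  · rfl

/-- The product of all denominators. -/
noncomputable def denProd : Polynomial Kq := ∏ l ∈ Finset.range P.length, poly₂ (P.den l)

/-- The polynomial with zeros `q⁻¹, …, q ^ (-length)`. -/
noncomputable def guard : Polynomial Kq :=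
  ∏ t ∈ Finset.range P.length, (1 - Polynomial.C (q ^ (t + 1)) * Polynomial.X)

/-- The polynomial in `Q` underlying `coeffCode`. -/
noncomputable def poly (i : ℕ) : Polynomial Kq :=
  poly₂ (P.num i) * (∏ l ∈ Finset.range P.length, if l = i then 1 else poly₂ (P.den l)) *
    P.denProd * P.guard

theorem poly_eq_zero_of_length_le {i : ℕ} (h : P.length ≤ i) : P.poly i = 0 := by
  simp [poly, P.poly₂_num_eq_zero h]

theorem eval_poly {x : Kq} (hx : P.denProd.eval x ≠ 0) {i : ℕ} (hi : i < P.length) :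
    (P.poly i).eval x = P.denProd.eval x ^ 2 * P.guard.eval x *
      ((poly₂ (P.num i)).eval x / (poly₂ (P.den i)).eval x) := by
  have hprod : P.denProd = poly₂ (P.den i) *
      ∏ l ∈ Finset.range P.length, if l = i then 1 else poly₂ (P.den l) := by
    rw [denProd, ← Finset.mul_prod_erase _ _ (Finset.mem_range.2 hi),
      ← Finset.mul_prod_erase _ (fun l => ite _ _ _) (Finset.mem_range.2 hi), if_pos rfl, one_mul]
    refine congrArg _ (Finset.prod_congr rfl fun l hl => ?_)
    rw [if_neg (Finset.ne_of_mem_erase hl)]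
  have heval := congrArg (Polynomial.eval x) hprod
  rw [Polynomial.eval_mul] at heval
  have hi : (poly₂ (P.den i)).eval x ≠ 0 := left_ne_zero_of_mul (heval ▸ hx)
  simp only [poly, Polynomial.eval_mul]
  rw [heval]
  field_simp

theorem eval_guard_eq_zero {m : ℤ} (hm : m < 0) (hlen : 0 ≤ m + P.length) :
    P.guard.eval (q ^ m) = 0 := by
  obtain ⟨t, rfl⟩ := Int.eq_negSucc_of_lt_zero hm
  rw [guard, Polynomial.eval_prod]
  refine Finset.prod_eq_zero (Finset.mem_range.2 (by omega : t < P.length)) ?_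
  simp [q_ne_zero]

variable {P} {J : ℕ → Kq}

theorem sum_eval_div_mul (hJ : Satisfies J P.toEq) {n : ℕ} (hn : P.denProd.eval (q ^ n) ≠ 0) :
    ∑ i ∈ Finset.range P.length,
      (poly₂ (P.num i)).eval (q ^ n) / (poly₂ (P.den i)).eval (q ^ n) * J (n + i) = 0 := by
  have hden (i : Fin P.toEq.length) : (poly₂ (P.den i)).eval (q ^ n) ≠ 0 := by
    rw [denProd, Polynomial.eval_prod, Finset.prod_ne_zero_iff] at hn
    exact hn i (Finset.mem_range.2 (P.length_toEq ▸ i.2))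
  have hdefined : ∀ a ∈ P.toEq, DefinedAt a n := fun a ha => by
    obtain ⟨i, rfl⟩ := List.get_of_mem ha
    rw [P.toEq_get i.2]
    exact definedAt_div (hden i)
  rw [← P.length_toEq, Finset.sum_range, ← hJ n hdefined]
  exact Finset.sum_congr rfl fun i _ => by rw [P.toEq_get i.2, valueAt_div (hden i)]

theorem sum_eval_poly_mul_extend (hJ : Satisfies J P.toEq) (m : ℤ) :
    ∑ i ∈ Finset.range P.length, (P.poly i).eval (q ^ m) * extend J (m + i) = 0 := by
  obtain hm | hm := lt_or_ge m 0
  · refine Finset.sum_eq_zero fun i hi => ?_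
    rw [Finset.mem_range] at hi
    obtain hmi | hmi := lt_or_ge (m + i) 0
    · rw [extend_of_neg J hmi, mul_zero]
    · rw [poly, Polynomial.eval_mul, P.eval_guard_eq_zero hm (by omega), mul_zero, zero_mul]
  · lift m to ℕ using hm
    rw [zpow_natCast]
    by_cases hden : P.denProd.eval (q ^ m) = 0
    · exact Finset.sum_eq_zero fun i _ => by simp [poly, hden]
    · rw [← mul_zero (P.denProd.eval (q ^ m) ^ 2 * P.guard.eval (q ^ m)),
        ← sum_eval_div_mul hJ hden, Finset.mul_sum]
      refine Finset.sum_congr rfl fun i hi => ?_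
      rw [P.eval_poly hden (Finset.mem_range.1 hi), ← Nat.cast_add, extend_natCast, mul_assoc]

end EqCode

/-! ### Validity of certificates -/

section Soundness

variable {F : Type*} [Field F] {κ : Kq →+* F} {z : Fˣ}

theorem ev_coeffCode (n k : ℤ) (P : EqCode) (l i : ℕ) :
    ev κ z n k (P.coeffCode (single (1, (l : ℤ), 0, 0)) i).val =
      κ ((P.poly i).eval (q ^ (k + l))) := by
  have hx : ev κ z n k (single (1, (l : ℤ), 0, 0)).val = κ (q ^ (k + l)) := by
    simp [add_comm]
  have hcode (p : List (List ℤ)) : ev κ z n k (intCode₂ qCode (single (1, (l : ℤ), 0, 0)) p).val =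
      κ ((poly₂ p).eval (q ^ (k + l))) := by
    rw [map_intCode₂ (ev_qCode κ z n k), hx, eval_poly₂, map_coeffEval, List.map_map]
    rfl
  have hite (j : ℕ) : ev κ z n k
      (if j = i then 1 else intCode₂ qCode (single (1, (l : ℤ), 0, 0)) (P.den j)).val =
        κ ((if j = i then 1 else poly₂ (P.den j)).eval (q ^ (k + l))) := by
    split_ifs
    · simp
    · exact hcode _
  simp only [EqCode.coeffCode, EqCode.poly, EqCode.denProd, EqCode.guard, val_mul, val_list_prod,
    List.map_map, Function.comp_def, prod_map_range, map_mul, map_prod, Polynomial.eval_mul,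
    Polynomial.eval_prod, hcode, hite]
  simp [add_comm (l : ℤ)]

theorem sum_range_ite_sub {M : Type*} [AddCommMonoid M] (g : ℕ → M) {l m N : ℕ} (h : l + m ≤ N)
    (hg : ∀ i, m ≤ i → g i = 0) :
    (∑ j ∈ Finset.range N, if l ≤ j then g (j - l) else 0) = ∑ i ∈ Finset.range m, g i := by
  obtain ⟨r, rfl⟩ := Nat.exists_eq_add_of_le h
  rw [add_assoc, Finset.sum_range_add, Finset.sum_range_add,
    Finset.sum_eq_zero fun j hj => if_neg (by simpa using hj), zero_add]
  simp [hg]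

namespace Certificate

variable {P : EqCode} {T : TermCode} {c : Certificate}

theorem ev_termRelation (n k : ℤ) (j : ℕ) : ev κ z n k (c.termRelation P T j).val =
    ∑ i ∈ Finset.range (c.order + 1),
        coeffEv κ z n (c.α i j).val * ev κ z n k (T.shiftCode c.order i j).val -
      ∑ l ∈ Finset.range (c.order + 2 - P.length), ev κ z n k (c.β l).val *
        if l ≤ j then κ ((P.poly (j - l)).eval (q ^ (k + l))) else 0 := by
  have hmap (r : CoeffCode) : ev κ z n k (r.map fun m => ((0 : ℤ), m)).val =
      coeffEv κ z n r.val :=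
    (congrArg _ (val_map (AddMonoidHom.inr ℤ (ℤ × ℤ × ℤ)) r)).trans (ev_mapDomain_inr κ z n k _)
  have hite (l : ℕ) : ev κ z n k
      (if l ≤ j then c.β l * P.coeffCode (single (1, (l : ℤ), 0, 0)) (j - l) else 0).val =
        ev κ z n k (c.β l).val *
          if l ≤ j then κ ((P.poly (j - l)).eval (q ^ (k + l))) else 0 := by
    split_ifs
    · rw [val_mul, map_mul, ev_coeffCode]
    · rw [val_zero, map_zero, mul_zero]
  simp only [termRelation, val_sub, val_list_sum, List.map_map, Function.comp_def, sum_map_range,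
    map_sub, map_sum, val_mul, map_mul, hmap, hite]

theorem IsValid.sum_α_mul_termFun (hc : c.IsValid P T) (hξ : T.ξ.val ≠ 0) (hη : T.η.val ≠ 0)
    (hreg : ∀ f ∈ T.shiftFactors, f.IsRegular κ z) {J : ℕ → Kq} (hJ : Satisfies J P.toEq)
    (n k : ℤ) :
    ∑ j ∈ Finset.range (c.order + 1), ∑ i ∈ Finset.range (c.order + 1),
      coeffEv κ z n (c.α i j).val * termFun κ z T (n + i) (k + j) * κ (extend J (k + j)) = 0 := by
  obtain ⟨b, hb⟩ := isShiftCode_shiftCode κ z (N := c.order) hξ hη hreg n k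
  have hrel : ∀ j ∈ Finset.range (c.order + 1), ∑ i ∈ Finset.range (c.order + 1),
      coeffEv κ z n (c.α i j).val * ev κ z n k (T.shiftCode c.order i j).val =
      ∑ l ∈ Finset.range (c.order + 2 - P.length), ev κ z n k (c.β l).val *
        if l ≤ j then κ ((P.poly (j - l)).eval (q ^ (k + l))) else 0 := fun j hj => by
    rw [← sub_eq_zero, ← ev_termRelation, (isZero_iff _).1 (hc.1 j (by simpa using hj)), map_zero]
  have heq (l : ℕ) (hl : l ∈ Finset.range (c.order + 2 - P.length)) :
      ∑ j ∈ Finset.range (c.order + 1), (if l ≤ j then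
        κ ((P.poly (j - l)).eval (q ^ (k + l)) * extend J (k + l + (j - l : ℕ))) else 0) = 0 := by
    rw [sum_range_ite_sub (fun i => κ ((P.poly i).eval (q ^ (k + l)) * extend J (k + l + (i : ℕ))))
      (m := P.length) (by have := Finset.mem_range.1 hl; omega)
      fun i hi => by simp [P.poly_eq_zero_of_length_le hi], ← map_sum,
      EqCode.sum_eval_poly_mul_extend hJ, map_zero]
  calc
    _ = b * ∑ j ∈ Finset.range (c.order + 1), (∑ i ∈ Finset.range (c.order + 1),
          coeffEv κ z n (c.α i j).val * ev κ z n k (T.shiftCode c.order i j).val) *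
          κ (extend J (k + j)) := by
      simp only [Finset.mul_sum, Finset.sum_mul]
      refine Finset.sum_congr rfl fun j hj => Finset.sum_congr rfl fun i hi => ?_
      rw [hb i (Finset.mem_range_succ_iff.1 hi) j (Finset.mem_range_succ_iff.1 hj)]
      ring
    _ = b * ∑ l ∈ Finset.range (c.order + 2 - P.length), ev κ z n k (c.β l).val *
          ∑ j ∈ Finset.range (c.order + 1), (if l ≤ j then
            κ ((P.poly (j - l)).eval (q ^ (k + l)) * extend J (k + l + (j - l : ℕ))) else 0) := by
      rw [Finset.sum_congr rfl fun j hj => congrArg (· * _) (hrel j hj)]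
      simp only [Finset.sum_mul, Finset.mul_sum]
      rw [Finset.sum_comm]
      refine Finset.sum_congr rfl fun l _ => Finset.sum_congr rfl fun j _ => ?_
      split_ifs with hlj
      · rw [map_mul, mul_assoc, Nat.cast_sub hlj, add_assoc, add_sub_cancel]
      · rw [mul_zero, zero_mul]
    _ = 0 := by
      rw [Finset.sum_eq_zero fun l hl => by rw [heq l hl, mul_zero], mul_zero]

end Certificate

theorem inv_qPoch_self_of_neg {q : F} (hq : q ≠ 0) {s : ℤ} (hs : s < 0) : (qPoch q q s)⁻¹ = 0 := by
  obtain ⟨m, rfl⟩ := Int.eq_negSucc_of_lt_zero hs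
  refine (inv_inv _).trans (Finset.prod_eq_zero (Finset.mem_range.2 m.succ_pos) ?_)
  simp [hq]

theorem val_qRat : RatCode.val ([0, 1], [1]) = q := by
  simp [RatCode.val, intPoly_eq_coeffEval]

theorem termFun_eq_zero (T : TermCode) {n k : ℤ} (h : k < 0 ∨ n < k) : termFun κ z T n k = 0 := by
  have hq : κ q ≠ 0 := (map_ne_zero κ).2 q_ne_zero
  suffices ∃ f ∈ T.shiftFactors, f.fn κ z (f.form.eval n k) = 0 by
    rw [termFun, List.prod_eq_zero (List.mem_map.2 this), mul_zero]
  obtain hk | hk := h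
  · refine ⟨⟨([0, 1], [1]), false, ⟨0, -1, 0⟩, true⟩,
      by simp [TermCode.shiftFactors, boundaryFactors], ?_⟩
    simpa [ShiftFactor.fn, ShiftFactor.param, LinForm.eval, val_qRat] using
      inv_qPoch_self_of_neg hq hk
  · refine ⟨⟨([0, 1], [1]), false, ⟨-1, 1, 0⟩, true⟩,
      by simp [TermCode.shiftFactors, boundaryFactors], ?_⟩
    simpa [ShiftFactor.fn, ShiftFactor.param, LinForm.eval, val_qRat, neg_add_eq_sub] using
      inv_qPoch_self_of_neg hq (sub_neg.2 hk)

theorem isRegular_of_perturbed (hz : ∀ x : Kq, κ x * z ≠ 1) {f : ShiftFactor}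
    (hf : f.perturbed = true) : f.IsRegular κ z := fun s _ h => by
  refine hz (f.x.val * q ^ s) ?_
  rw [ShiftFactor.param, hf, cond_true, sub_eq_zero] at h
  rw [h, map_mul, map_zpow₀]
  ring

theorem isRegular_of_mem (hz : ∀ x : Kq, κ x * z ≠ 1) {T : TermCode} {f : ShiftFactor}
    (hf : f ∈ T.shiftFactors) : f.IsRegular κ z := by
  have hcases : f.perturbed = true ∨ f.perturbed = false ∧ f.x = ([0, 1], [1]) ∧ f.inverse := by
    simp only [TermCode.shiftFactors, List.mem_append, List.mem_flatMap, QFactor.shiftFactors,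
      QFactor.invShiftFactors, boundaryFactors, List.mem_cons, List.not_mem_nil, or_false] at hf
    rcases hf with ⟨_, -, rfl | rfl⟩ | ⟨_, -, rfl | rfl⟩ | rfl | rfl | rfl | rfl <;> simp
  obtain hf | ⟨hf, hx, hinv⟩ := hcases
  · exact isRegular_of_perturbed hz hf
  · intro s hs
    rw [ShiftFactor.param, hf, hx, val_qRat, cond_false, mul_one, ← map_zpow₀, ← map_mul,
      ← zpow_one_add₀ q_ne_zero, ← map_one κ, ← map_sub, map_ne_zero, sub_ne_zero]
    rw [if_pos hinv] at hs
    exact (q_zpow_ne_one (by omega)).symm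

end Soundness

/-! ### Specialization of the perturbation parameter -/

open PowerSeries (constantCoeff)

section Specialization

section Field

variable (k F : Type*) [Field k] [Field F] [Algebra (PowerSeries k) F]

/-- The graph of the evaluation of power series at `0`, with power series viewed as elements
of `F`. -/
noncomputable def specialization : Subring (F × k) :=
  ((algebraMap (PowerSeries k) F).prod constantCoeff).range

/-- The embedding of the constants. -/
noncomputable def ofConst : k →+* F := (algebraMap (PowerSeries k) F).comp PowerSeries.C

/-- The perturbation parameter `z = 1 + X`, which specializes to `1`. -/
noncomputable def perturbation [IsFractionRing (PowerSeries k) F] : Fˣ :=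
  Units.mk0 (algebraMap (PowerSeries k) F (1 + PowerSeries.X)) <| by
    rw [Ne, map_eq_zero_iff _ (IsFractionRing.injective (PowerSeries k) F)]
    exact fun h => by simpa using congrArg constantCoeff h

variable {k F}

/-- `x` is the image of a power series with constant coefficient `v`. -/
def SpecializesTo (x : F) (v : k) : Prop := (x, v) ∈ specialization k F

namespace SpecializesTo

variable {x y : F} {v w : k}

theorem mk {s : PowerSeries k} (hx : algebraMap (PowerSeries k) F s = x)
    (hv : constantCoeff s = v) : SpecializesTo x v :=
  ⟨s, Prod.ext hx hv⟩

theorem ofConst (x : k) : SpecializesTo (ofConst k F x) x :=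
  .mk rfl (PowerSeries.constantCoeff_C x)

theorem one : SpecializesTo (1 : F) (1 : k) := (specialization k F).one_mem

theorem add (hx : SpecializesTo x v) (hy : SpecializesTo y w) : SpecializesTo (x + y) (v + w) :=
  add_mem hx hy

theorem sub (hx : SpecializesTo x v) (hy : SpecializesTo y w) : SpecializesTo (x - y) (v - w) :=
  sub_mem hx hy

theorem mul (hx : SpecializesTo x v) (hy : SpecializesTo y w) : SpecializesTo (x * y) (v * w) :=
  mul_mem hx hy

theorem inv (hv : v ≠ 0) : SpecializesTo x v → SpecializesTo x⁻¹ v⁻¹ := by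
  rintro ⟨s, hs⟩
  obtain ⟨rfl, rfl⟩ := Prod.ext_iff.1 hs
  refine .mk (s := s⁻¹) (eq_inv_of_mul_eq_one_right ?_) (PowerSeries.constantCoeff_inv s)
  exact (map_mul _ _ _).symm.trans (by rw [PowerSeries.mul_inv_cancel s hv, map_one])

theorem zpow (hv : v ≠ 0) (hx : SpecializesTo x v) (n : ℤ) : SpecializesTo (x ^ n) (v ^ n) := by
  have hpow (n : ℕ) : SpecializesTo (x ^ n) (v ^ n) := pow_mem (S := specialization k F) hx n
  cases n with
  | ofNat n => simpa using hpow n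
  | negSucc n =>
    rw [zpow_negSucc, zpow_negSucc]
    exact (hpow _).inv (pow_ne_zero _ hv)

theorem sum {ι : Type*} {s : Finset ι} {x : ι → F} {v : ι → k}
    (h : ∀ i ∈ s, SpecializesTo (x i) (v i)) : SpecializesTo (∑ i ∈ s, x i) (∑ i ∈ s, v i) := by
  rw [SpecializesTo, prod_mk_sum]
  exact sum_mem h

theorem prod {ι : Type*} {s : Finset ι} {x : ι → F} {v : ι → k}
    (h : ∀ i ∈ s, SpecializesTo (x i) (v i)) : SpecializesTo (∏ i ∈ s, x i) (∏ i ∈ s, v i) := by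
  rw [SpecializesTo, prod_mk_prod]
  exact prod_mem h

theorem list_prod {ι : Type*} {l : List ι} {x : ι → F} {v : ι → k}
    (h : ∀ i ∈ l, SpecializesTo (x i) (v i)) : SpecializesTo (l.map x).prod (l.map v).prod := by
  induction l with
  | nil => exact one
  | cons i l ih =>
    simp only [List.map_cons, List.prod_cons]
    exact (h i List.mem_cons_self).mul (ih fun j hj => h j (List.mem_cons_of_mem i hj))

end SpecializesTo

variable [IsFractionRing (PowerSeries k) F]

theorem SpecializesTo.eq_zero {v : k} : SpecializesTo (0 : F) v → v = 0 := by
  rintro ⟨s, hs⟩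
  obtain ⟨hs, rfl⟩ := Prod.ext_iff.1 hs
  rw [(map_eq_zero_iff _ (IsFractionRing.injective (PowerSeries k) F)).1 hs]
  exact map_zero _

variable (k F)

theorem specializesTo_perturbation : SpecializesTo (perturbation k F : F) (1 : k) :=
  .mk rfl (by simp)

theorem ofConst_mul_perturbation_ne_one (x : k) : ofConst k F x * perturbation k F ≠ 1 := by
  intro h
  have hseries : PowerSeries.C x * (1 + PowerSeries.X) = 1 :=
    IsFractionRing.injective (PowerSeries k) F
      ((map_mul _ _ _).trans (h.trans (map_one _).symm))
  have hx : x = 1 := by simpa using congrArg constantCoeff hseries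
  simpa [hx, PowerSeries.coeff_one] using congrArg (PowerSeries.coeff 1) hseries

theorem perturbation_ne_one : (perturbation k F : F) ≠ 1 := fun h =>
  ofConst_mul_perturbation_ne_one k F 1 (by rw [map_one, one_mul, h])

end Field

variable (F : Type*) [Field F] [Algebra (PowerSeries Kq) F] [IsFractionRing (PowerSeries Kq) F]

theorem exists_specializesTo_coeffEv (n : ℤ) (r : AddMonoidAlgebra ℤ (ℤ × ℤ × ℤ)) :
    ∃ v : Kq, SpecializesTo (coeffEv (ofConst Kq F) (perturbation Kq F) n r) v := by
  induction r using AddMonoidAlgebra.induction_on with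
  | of m =>
    obtain ⟨a, b, c⟩ := m
    rw [AddMonoidAlgebra.of_apply, toAdd_ofAdd, coeffEv_single]
    exact ⟨q ^ (a + n * c) * 1 ^ b, ((SpecializesTo.ofConst q).zpow q_ne_zero _).mul
      ((specializesTo_perturbation Kq F).zpow one_ne_zero b)⟩
  | add r s hr hs =>
    obtain ⟨⟨v, hv⟩, ⟨w, hw⟩⟩ := hr, hs
    exact ⟨v + w, by rw [map_add]; exact hv.add hw⟩
  | smul c r hr =>
    obtain ⟨v, hv⟩ := hr
    refine ⟨c • v, ?_⟩
    rw [map_zsmul]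
    exact zsmul_mem (K := specialization Kq F) hv c

variable {F}

theorem specializesTo_one_sub (x : Kq) (t : ℤ) :
    SpecializesTo (1 - ofConst Kq F x * perturbation Kq F * ofConst Kq F q ^ t)
      (1 - x * q ^ t) := by
  have h := ((SpecializesTo.ofConst (F := F) x).mul (specializesTo_perturbation Kq F)).mul
    ((SpecializesTo.ofConst q).zpow q_ne_zero t)
  rw [mul_one] at h
  exact .sub .one h

theorem specializesTo_qPoch {x : Kq} {m : ℤ} (h : QFactorialDefined x m) :
    SpecializesTo (qPoch (ofConst Kq F q) (ofConst Kq F x * perturbation Kq F) m)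
      (qFactorial x m) := by
  cases m with
  | ofNat m => exact .prod fun i _ => by simpa using specializesTo_one_sub (F := F) x i
  | negSucc m =>
    refine (SpecializesTo.prod fun i _ => specializesTo_one_sub x _).inv
      (Finset.prod_ne_zero_iff.2 fun i hi => ?_)
    rw [Finset.mem_range] at hi
    exact h _ (by omega) (by omega)

theorem specializesTo_inv_qPoch {x : Kq} {m : ℤ} (h : InvQFactorialDefined x m) :
    SpecializesTo (qPoch (ofConst Kq F q) (ofConst Kq F x * perturbation Kq F) m)⁻¹
      (qFactorial x m)⁻¹ := by
  cases m with
  | ofNat m =>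
    refine SpecializesTo.inv (Finset.prod_ne_zero_iff.2 fun i hi => ?_)
      (.prod fun i _ => by simpa using specializesTo_one_sub (F := F) x i)
    rw [Finset.mem_range] at hi
    simpa using h i (by omega) (by simpa using hi)
  | negSucc m =>
    simp only [qPoch, qFactorial, inv_inv]
    exact .prod fun i _ => specializesTo_one_sub x _

theorem specializesTo_boundary (m : ℕ) :
    SpecializesTo (qPoch (ofConst Kq F q) (ofConst Kq F q * perturbation Kq F) m *
      (qPoch (ofConst Kq F q) (ofConst Kq F q) m)⁻¹) (1 : Kq) := by
  have hconst : qPoch (ofConst Kq F q) (ofConst Kq F q) m = ofConst Kq F (qFactorial q m) := by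
    simp [qPoch, qFactorial]
  have hne : qFactorial q m ≠ 0 := Finset.prod_ne_zero_iff.2 fun i _ => by
    rw [← pow_succ', sub_ne_zero]
    exact mod_cast (q_zpow_ne_one (n := (i + 1 : ℕ)) (by omega)).symm
  have hdefined : QFactorialDefined q m := fun j hj hj' => by omega
  rw [hconst, ← mul_inv_cancel₀ hne]
  exact (specializesTo_qPoch hdefined).mul ((SpecializesTo.ofConst _).inv hne)

theorem qPoch_perturbed (f : QFactor) (n k : ℕ) :
    qPoch (ofConst Kq F q) (ofConst Kq F (f.arg n k) * perturbation Kq F) (f.m.val n k) =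
      qPoch (ofConst Kq F q) (ofConst Kq F f.x.val * perturbation Kq F)
          (f.s.val n k + f.m.val n k) *
        (qPoch (ofConst Kq F q) (ofConst Kq F f.x.val * perturbation Kq F) (f.s.val n k))⁻¹ := by
  rw [← qPoch_mul_zpow ((map_ne_zero _).2 q_ne_zero), QFactor.arg, map_mul, map_zpow₀,
    mul_right_comm]
  intro s h
  refine ofConst_mul_perturbation_ne_one Kq F (f.x.val * q ^ s) ?_
  rw [map_mul, map_zpow₀, mul_right_comm]
  exact (sub_eq_zero.1 h).symm

theorem specializesTo_shiftFactors {T : TermCode} (hT : T.IsValid) {n k : ℕ} (hk : k ≤ n) :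
    SpecializesTo (T.shiftFactors.map fun f =>
        f.fn (ofConst Kq F) (perturbation Kq F) (f.form.eval n k)).prod
      ((T.num.map fun f => f.val n k).prod * (T.den.map fun f => (f.val n k)⁻¹).prod) := by
  obtain ⟨hnum, hden⟩ := hT.2.2 n k hk
  have hboundary :=
    (specializesTo_boundary (F := F) k).mul (specializesTo_boundary (F := F) (n - k))
  rw [one_mul] at hboundary
  have hflat (l : List QFactor) (g : QFactor → List ShiftFactor) (h : ShiftFactor → F) :
      ((l.flatMap g).map h).prod = (l.map fun f => ((g f).map h).prod).prod := by
    induction l <;> simp [*]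
  rw [TermCode.shiftFactors, List.map_append, List.prod_append, List.map_append, List.prod_append,
    ← mul_assoc, hflat, hflat, ← mul_one ((T.num.map fun f => f.val n k).prod * _)]
  refine ((SpecializesTo.list_prod (k := Kq) (F := F) fun f hf => ?_).mul
    (.list_prod fun f hf => ?_)).mul ?_
  · have h := specializesTo_qPoch (F := F) (hnum f hf)
    rw [qPoch_perturbed] at h
    simp only [QFactor.shiftFactors, ShiftFactor.fn, ShiftFactor.param, LinForm.eval_add,
      LinForm.eval_neg, neg_neg, List.map_cons, List.map_nil, List.prod_pair, cond_true, cond_false]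
    exact h
  · have h := specializesTo_inv_qPoch (F := F) (hden f hf)
    rw [qPoch_perturbed, mul_inv, inv_inv, mul_comm] at h
    simp only [QFactor.invShiftFactors, ShiftFactor.fn, ShiftFactor.param, LinForm.eval_add,
      LinForm.eval_neg, neg_neg, List.map_cons, List.map_nil, List.prod_pair, cond_true, cond_false]
    exact h
  · convert hboundary using 1
    simp only [boundaryFactors, ShiftFactor.fn, ShiftFactor.param, LinForm.eval, val_qRat,
      Nat.cast_sub hk, List.map_cons, List.map_nil, List.prod_cons, List.prod_nil, cond_true,
      cond_false, mul_one]
    ring_nf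

theorem specializesTo_termFun {T : TermCode} (hT : T.IsValid) {n k : ℕ} (hk : k ≤ n) :
    SpecializesTo (termFun (ofConst Kq F) (perturbation Kq F) T n k) (T.val n k) := by
  rw [termFun, TermCode.val, polyVal_natCast, QuadForm.eval_natCast, mul_assoc (_ * q ^ _),
    ← zpow_natCast, ← zpow_natCast]
  exact ((((SpecializesTo.ofConst _).mul ((SpecializesTo.ofConst _).zpow hT.1 _)).mul
    ((SpecializesTo.ofConst _).zpow hT.2.1 _)).mul
    ((SpecializesTo.ofConst _).zpow q_ne_zero _)).mul (specializesTo_shiftFactors hT hk)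

end Specialization

/-! ### The equation of the sum -/

theorem sum_sum_mul_finsum_eq_zero {R : Type*} [Ring R] [NoZeroDivisors R] {s t : Finset ℕ}
    {a : ℕ → ℕ → R} {g : ℕ → ℤ → R} (hg : ∀ i, (Function.support (g i)).Finite)
    (h : ∀ k : ℤ, ∑ j ∈ s, ∑ i ∈ t, a i j * g i (k + j) = 0) :
    ∑ i ∈ t, (∑ j ∈ s, a i j) * ∑ᶠ k, g i k = 0 := by
  have hshift (i j : ℕ) : (Function.support fun k : ℤ => a i j * g i (k + j)).Finite :=
    ((hg i).preimage (add_left_injective (j : ℤ)).injOn).subset fun _ hk => right_ne_zero_of_mul hk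
  calc
    _ = ∑ j ∈ s, ∑ i ∈ t, ∑ᶠ k : ℤ, a i j * g i (k + j) := by
      rw [Finset.sum_comm]
      refine Finset.sum_congr rfl fun i _ => ?_
      rw [Finset.sum_mul]
      refine Finset.sum_congr rfl fun j _ => ?_
      rw [← mul_finsum, ← finsum_comp_equiv (Equiv.addRight (j : ℤ))]
      rfl
    _ = ∑ᶠ k : ℤ, ∑ j ∈ s, ∑ i ∈ t, a i j * g i (k + j) := by
      rw [finsum_sum_comm _ _ fun j _ => (t.finite_toSet.biUnion fun i _ => hshift i j).subset
        fun k hk => ?_]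
      · exact Finset.sum_congr rfl fun j _ => (finsum_sum_comm _ _ fun i _ => hshift i j).symm
      · obtain ⟨i, hi, hne⟩ := Finset.exists_ne_zero_of_sum_ne_zero hk
        exact Set.mem_biUnion hi hne
    _ = 0 := by simp only [h, finsum_zero]

section WeightedSummand

variable {F : Type*} [Field F] (κ : Kq →+* F) (z : Fˣ)

/-- The perturbed summand, multiplied by `z ^ (-w * k)`. -/
noncomputable def weightedSummand (T : TermCode) (J : ℕ → Kq) (w : ℕ) (n k : ℤ) : F :=
  termFun κ z T n k * κ (extend J k) * (z : F) ^ (-(w : ℤ) * k)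

theorem support_weightedSummand_subset (T : TermCode) (J : ℕ → Kq) (w n : ℕ) :
    Function.support (weightedSummand κ z T J w n) ⊆
      ↑((Finset.range (n + 1)).map (Nat.castEmbedding (R := ℤ))) := fun k hk => by
  obtain ⟨hk0, hkn⟩ : 0 ≤ k ∧ k ≤ n := by
    by_contra! hk'
    refine hk ?_
    rw [weightedSummand, termFun_eq_zero T (by omega), zero_mul, zero_mul]
  exact mod_cast Finset.mem_map.2 ⟨k.toNat, by simp; omega, by simpa using hk0⟩

theorem finsum_weightedSummand (T : TermCode) (J : ℕ → Kq) (w n : ℕ) :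
    ∑ᶠ k, weightedSummand κ z T J w n k =
      ∑ k ∈ Finset.range (n + 1), weightedSummand κ z T J w n k := by
  rw [finsum_eq_sum_of_support_subset _ (support_weightedSummand_subset κ z T J w n),
    Finset.sum_map]
  rfl

variable {κ z} {P : EqCode} {T : TermCode} {c : Certificate}

namespace Certificate

theorem IsValid.sum_α_mul_finsum (hc : c.IsValid P T) (hT : T.IsValid)
    (hz : ∀ x : Kq, κ x * z ≠ 1) {J : ℕ → Kq} (hJ : Satisfies J P.toEq) (n : ℕ) :
    ∑ i ∈ Finset.range (c.order + 1),
      (∑ j ∈ Finset.range (c.order + 1), coeffEv κ z n (c.α i j).val * (z : F) ^ (c.weight * j)) *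
        ∑ᶠ k, weightedSummand κ z T J c.weight (n + i : ℕ) k = 0 := by
  refine sum_sum_mul_finsum_eq_zero
    (fun i => (Finset.finite_toSet _).subset (support_weightedSummand_subset κ z T J _ _))
    fun k => ?_
  have hα := hc.sum_α_mul_termFun hT.1 hT.2.1 (fun f => isRegular_of_mem hz) hJ n k
  have hpow (j : ℕ) : (z : F) ^ (-(c.weight : ℤ) * k) =
      (z : F) ^ (c.weight * j) * (z : F) ^ (-(c.weight : ℤ) * (k + j)) := by
    rw [← zpow_natCast, ← zpow_add₀ z.ne_zero]
    congr 1
    push_cast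
    ring
  calc
    _ = (∑ j ∈ Finset.range (c.order + 1), ∑ i ∈ Finset.range (c.order + 1),
          coeffEv κ z n (c.α i j).val * termFun κ z T (n + i) (k + j) * κ (extend J (k + j))) *
          (z : F) ^ (-(c.weight : ℤ) * k) := by
      simp only [Finset.sum_mul]
      refine Finset.sum_congr rfl fun j _ => Finset.sum_congr rfl fun i _ => ?_
      rw [weightedSummand, hpow j]
      push_cast
      ring
    _ = 0 := by rw [hα, zero_mul]

theorem IsValid.sum_α_mul_pow (hc : c.IsValid P T) (n : ℕ) {i : ℕ}
    (hi : i ∈ Finset.range (c.order + 1)) :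
    ∑ j ∈ Finset.range (c.order + 1), coeffEv κ z n (c.α i j).val * (z : F) ^ (c.weight * j) =
      ((z : F) - 1) ^ c.multiplicity * (κ ((poly₂ (c.A i)).eval (q ^ n)) +
        ((z : F) - 1) * coeffEv κ z n (c.B i).val) := by
  have h := congrArg (coeffEv κ z n) ((isZero_iff _).1 (hc.2.1 i (by simpa using hi)))
  have hq : coeffEv κ z n (single (1, 0, 0)).val = κ q := by simp
  have hA : coeffEv κ z n (intCode₂ (single (1, 0, 0)) (single (0, 0, 1)) (c.A i)).val =
      κ ((poly₂ (c.A i)).eval (q ^ n)) := by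
    rw [map_intCode₂ hq, eval_poly₂, map_coeffEval, List.map_map]
    simp [Function.comp_def]
  simp only [sumRelation, zSubOne, val_sub, val_add, val_mul, val_pow, val_list_sum, List.map_map,
    sum_map_range, map_sub, map_add, map_mul, map_pow, map_sum, Function.comp_apply, val_one,
    map_one, hA, map_zero, sub_eq_zero] at h
  simpa only [val_single, coeffEv_single, mul_zero, add_zero, zpow_zero, one_mul, zpow_natCast,
    zpow_one] using h

end Certificate

end WeightedSummand

section Result

theorem poly₂_one : poly₂ [[1]] = 1 := by
  simp [poly₂, intPoly_eq_coeffEval]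

variable {P : EqCode} {T : TermCode} {c : Certificate}

theorem specializesTo_finsum_weightedSummand (F : Type*) [Field F] [Algebra (PowerSeries Kq) F]
    [IsFractionRing (PowerSeries Kq) F] (hT : T.IsValid) (J : ℕ → Kq) (w n : ℕ) :
    SpecializesTo (∑ᶠ k, weightedSummand (ofConst Kq F) (perturbation Kq F) T J w n k)
      (kernelSum T.val J n) := by
  rw [finsum_weightedSummand]
  refine .sum fun k hk => ?_
  have h := ((specializesTo_termFun (F := F) hT (Finset.mem_range_succ_iff.1 hk)).mul
    (.ofConst (J k))).mul
    ((specializesTo_perturbation Kq F).zpow one_ne_zero (-(w : ℤ) * k))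
  rwa [one_zpow, mul_one] at h

namespace Certificate

theorem IsValid.sum_eval_mul_kernelSum (hc : c.IsValid P T) (hT : T.IsValid) {J : ℕ → Kq}
    (hJ : Satisfies J P.toEq) (n : ℕ) :
    ∑ i ∈ Finset.range (c.order + 1), (poly₂ (c.A i)).eval (q ^ n) *
      kernelSum T.val J (n + i) = 0 := by
  let F := FractionRing (PowerSeries Kq)
  let κ := ofConst Kq F
  let z := perturbation Kq F
  let S (i : ℕ) : F := ∑ᶠ k, weightedSummand κ z T J c.weight (n + i : ℕ) k
  have hsum : ∑ i ∈ Finset.range (c.order + 1), (κ ((poly₂ (c.A i)).eval (q ^ n)) +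
      ((z : F) - 1) * coeffEv κ z n (c.B i).val) * S i = 0 := by
    refine mul_left_cancel₀
      (pow_ne_zero c.multiplicity (sub_ne_zero.2 (perturbation_ne_one Kq F))) ?_
    rw [mul_zero, ← hc.sum_α_mul_finsum hT (ofConst_mul_perturbation_ne_one Kq F) hJ n,
      Finset.mul_sum]
    refine Finset.sum_congr rfl fun i hi => ?_
    rw [hc.sum_α_mul_pow n hi, mul_assoc]
  refine SpecializesTo.eq_zero (F := F) (hsum ▸ SpecializesTo.sum fun i _ => ?_)
  obtain ⟨v, hv⟩ := exists_specializesTo_coeffEv F n (c.B i).val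
  have h := ((SpecializesTo.ofConst ((poly₂ (c.A i)).eval (q ^ n))).add
    (((specializesTo_perturbation Kq F).sub .one).mul hv)).mul
    (specializesTo_finsum_weightedSummand F hT J c.weight (n + i))
  rwa [sub_self, zero_mul, add_zero] at h

theorem toEq_output (c : Certificate) : c.output.toEq = (List.range (c.order + 1)).map fun i =>
    algebraMap _ KqQ (poly₂ (c.A i)) / algebraMap (Polynomial Kq) KqQ 1 := by
  rw [EqCode.toEq, output, List.map_map]
  refine List.map_congr_left fun i _ => ?_
  rw [Function.comp_apply, intPoly₂_eq_algebraMap, intPoly₂_eq_algebraMap, poly₂_one]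

theorem IsValid.satisfies_output (hc : c.IsValid P T) (hT : T.IsValid) {J : ℕ → Kq}
    (hJ : Satisfies J P.toEq) : Satisfies (kernelSum T.val J) c.output.toEq := by
  intro n _
  rw [← hc.sum_eval_mul_kernelSum hT hJ n, Finset.sum_fin_eq_sum_range]
  refine Finset.sum_congr (by simp [toEq_output]) fun i hi => ?_
  rw [Finset.mem_range] at hi
  rw [dif_pos (by simpa [toEq_output] using hi), List.get_eq_getElem]
  simp only [toEq_output, List.getElem_map, List.getElem_range]
  rw [valueAt_div (by simp), Polynomial.eval_one, div_one]

theorem IsValid.isNontrivial_output (hc : c.IsValid P T) : IsNontrivial c.output.toEq := by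
  obtain ⟨i, hi, h⟩ := hc.2.2
  refine ⟨_, toEq_output c ▸ List.mem_map_of_mem hi, ?_⟩
  rwa [map_one, div_one, ← intPoly₂_eq_algebraMap, Ne, intPoly₂_eq_zero_iff]

end Certificate

end Result

/-! ### Linear relations between Laurent polynomials of bounded degree -/

section BoundedDegree

variable {R : Type*} [CommRing R]

open LaurentPolynomial

variable (R) in
/-- The module of Laurent polynomials whose exponents lie between `-W` and `W`. -/
noncomputable def boundedDegree (W : ℕ) : Submodule R R[T;T⁻¹] :=
  AddMonoidAlgebra.supported R R (Set.Icc (-W : ℤ) W)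

variable {W W' : ℕ} {x y : R[T;T⁻¹]}

theorem boundedDegree_mono (h : W ≤ W') : boundedDegree R W ≤ boundedDegree R W' :=
  AddMonoidAlgebra.supported_mono (Set.Icc_subset_Icc (by simpa) (by simpa))

theorem single_mem_boundedDegree (r : R) {n : ℤ} (h : n.natAbs ≤ W) :
    (AddMonoidAlgebra.single n r : R[T;T⁻¹]) ∈ boundedDegree R W := by
  refine AddMonoidAlgebra.mem_supported'.2 fun m hm => ?_
  rw [AddMonoidAlgebra.coeff_single, Finsupp.single_eq_of_ne]
  rintro rfl
  exact hm (Set.mem_Icc.2 (by omega))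

theorem mul_mem_boundedDegree (hx : x ∈ boundedDegree R W) (hy : y ∈ boundedDegree R W') :
    x * y ∈ boundedDegree R (W + W') := by
  have h := Submodule.mul_mem_mul hx hy
  simp only [boundedDegree, AddMonoidAlgebra.supported_eq_span_single,
    Submodule.span_mul_span] at h
  refine Submodule.span_le.2 ?_ h
  rintro _ ⟨_, ⟨a, ha, rfl⟩, _, ⟨b, hb, rfl⟩, rfl⟩
  rw [Set.mem_Icc] at ha hb
  beta_reduce
  rw [AddMonoidAlgebra.single_mul_single]
  exact single_mem_boundedDegree _ (by omega)

theorem exists_sum_smul_eq_zero [Nontrivial R] {ι κ : Type*} {s : Finset ι} {t : Finset κ}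
    {v : ι → κ → R[T;T⁻¹]} (hv : ∀ i ∈ s, ∀ j ∈ t, v i j ∈ boundedDegree R W)
    (hcard : t.card * (2 * W + 1) < s.card) :
    ∃ c : ι → R, (∃ i ∈ s, c i ≠ 0) ∧ ∀ j ∈ t, ∑ i ∈ s, c i • v i j = 0 := by
  let u (i : ι) (p : t ×ˢ Finset.Icc (-W : ℤ) W) : R := (v i p.1.1).coeff p.1.2
  have hu : ¬LinearIndepOn R u s := fun h => by
    have hle := LinearIndependent.fintype_card_le_finrank h
    have hW : (W + 1 + W : ℤ).toNat = 2 * W + 1 := by omega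
    simp only [Finset.coe_sort_coe, Fintype.card_coe, Module.finrank_fintype_fun_eq_card,
      Finset.card_product, Int.card_Icc, sub_neg_eq_add, hW] at hle
    exact hcard.not_ge hle
  obtain ⟨c, hc, hne⟩ := not_linearIndepOn_finset_iff.1 hu
  refine ⟨c, hne, fun j hj => ?_⟩
  ext m
  by_cases hm : m ∈ Finset.Icc (-W : ℤ) W
  · simpa [u] using congrFun hc ⟨(j, m), Finset.mem_product.2 ⟨hj, hm⟩⟩
  · have := Submodule.sum_mem _ fun i hi => Submodule.smul_mem _ (c i) (hv i hi j hj)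
    exact AddMonoidAlgebra.mem_supported'.1 this m (by simpa using hm)

theorem eq_zero_of_sum_C_mul_T_eq_zero {s : Finset ℤ} {c : ℤ → R}
    (h : ∑ a ∈ s, C (c a) * T a = 0) {a : ℤ} (ha : a ∈ s) : c a = 0 := by
  have := congrArg (fun x => x.coeff a) h
  simpa [← single_eq_C_mul_T, AddMonoidAlgebra.coeff_sum, Finsupp.single_apply, ha] using this

end BoundedDegree

theorem eq_zero_of_sum_mul_shift_eq_zero {A : Type*} [Ring A] [NoZeroDivisors A] {L i₀ : ℕ}
    {β : ℕ → A} {p : ℕ → ℕ → A} (hp : ∀ l, p l i₀ ≠ 0) (hp₀ : ∀ l, ∀ i < i₀, p l i = 0)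
    (h : ∀ j < i₀ + L, ∑ l ∈ Finset.range L, (if l ≤ j then β l * p l (j - l) else 0) = 0)
    {l : ℕ} (hl : l < L) : β l = 0 := by
  induction l using Nat.strong_induction_on with
  | _ l ih =>
    specialize h (i₀ + l) (by omega)
    rw [Finset.sum_eq_single_of_mem l (Finset.mem_range.2 hl), if_pos (Nat.le_add_left ..),
      Nat.add_sub_cancel] at h
    · exact (mul_eq_zero.1 h).resolve_right (hp l)
    · intro l' hl' hne
      rw [Finset.mem_range] at hl'
      rw [ite_eq_right_iff]
      intro hle
      obtain hlt | hgt := lt_or_gt_of_ne hne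
      · rw [ih l' hlt hl', zero_mul]
      · rw [hp₀ _ _ (by omega), mul_zero]

section Recurrence

variable {R : Type*} [CommRing R] {n L i₀ W g : ℕ}

open LaurentPolynomial

variable {w p : ℕ → ℕ → R[T;T⁻¹]} (hw : ∀ i < n, ∀ j < n, w i j ∈ boundedDegree R (W + g))
  (hp : ∀ l i, p l i ∈ boundedDegree R g)
  (hcard : n * (2 * (W + g) + 1) < n * n + L * (2 * W + 1))
include hw hp hcard

theorem exists_relation [Nontrivial R] : ∃ (α : ℕ → ℕ → R) (β : ℕ → R[T;T⁻¹]),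
    ((∃ i < n, ∃ j < n, α i j ≠ 0) ∨ ∃ l < L, β l ≠ 0) ∧
      ∀ j < n, ∑ i ∈ Finset.range n, C (α i j) * w i j =
        ∑ l ∈ Finset.range L, if l ≤ j then β l * p l (j - l) else 0 := by
  let s := (Finset.range n ×ˢ Finset.range n).disjSum (Finset.range L ×ˢ Finset.Icc (-W : ℤ) W)
  let v : (ℕ × ℕ) ⊕ (ℕ × ℤ) → ℕ → R[T;T⁻¹] := Sum.elim
    (fun x j => if x.2 = j then w x.1 j else 0)
    (fun x j => -if x.1 ≤ j then T x.2 * p x.1 (j - x.1) else 0)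
  have hv : ∀ i ∈ s, ∀ j ∈ Finset.range n, v i j ∈ boundedDegree R (W + g) := by
    rintro (⟨i, j'⟩ | ⟨l, a⟩) hx j hj
    · simp only [s, Finset.inl_mem_disjSum, Finset.mem_product, Finset.mem_range] at hx hj
      dsimp only [v, Sum.elim_inl]
      split_ifs
      exacts [hw i hx.1 j hj, zero_mem _]
    · simp only [s, Finset.inr_mem_disjSum, Finset.mem_product, Finset.mem_Icc] at hx
      dsimp only [v, Sum.elim_inr]
      split_ifs
      exacts [neg_mem (mul_mem_boundedDegree (single_mem_boundedDegree 1 (by omega)) (hp _ _)),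
        neg_mem (zero_mem _)]
  have hs : (Finset.range n).card * (2 * (W + g) + 1) < s.card := by
    have hW : (W + 1 + W : ℤ).toNat = 2 * W + 1 := by omega
    simpa [s, hW] using hcard
  obtain ⟨c, ⟨x, hx, hcx⟩, hc⟩ := exists_sum_smul_eq_zero hv hs
  refine ⟨fun i j => c (.inl (i, j)),
    fun l => ∑ a ∈ Finset.Icc (-W : ℤ) W, C (c (.inr (l, a))) * T a, ?_, fun j hj => ?_⟩
  · obtain ⟨i, j⟩ | ⟨l, a⟩ := x
    · simp only [s, Finset.inl_mem_disjSum, Finset.mem_product, Finset.mem_range] at hx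
      exact .inl ⟨i, hx.1, j, hx.2, hcx⟩
    · simp only [s, Finset.inr_mem_disjSum, Finset.mem_product, Finset.mem_range] at hx
      exact .inr ⟨l, hx.1, fun h => hcx (eq_zero_of_sum_C_mul_T_eq_zero h hx.2)⟩
  · simpa [s, v, Finset.sum_product, hj, ← Finset.mul_sum, Finset.sum_mul, smul_eq_C_mul,
      mul_assoc, Finset.sum_ite_irrel, add_neg_eq_zero] using hc j (Finset.mem_range.2 hj)

theorem exists_recurrence [IsDomain R] (hp₁ : ∀ l, p l i₀ ≠ 0)
    (hp₀ : ∀ l, ∀ i < i₀, p l i = 0) (hL : i₀ + L ≤ n) :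
    ∃ (α : ℕ → ℕ → R) (β : ℕ → R[T;T⁻¹]), (∃ i < n, ∃ j < n, α i j ≠ 0) ∧
      ∀ j < n, ∑ i ∈ Finset.range n, C (α i j) * w i j =
        ∑ l ∈ Finset.range L, if l ≤ j then β l * p l (j - l) else 0 := by
  obtain ⟨α, β, hne, hrel⟩ := exists_relation hw hp hcard
  refine ⟨α, β, ?_, hrel⟩
  by_contra! hα
  obtain hne | ⟨l, hl, hβ⟩ := hne
  · obtain ⟨i, hi, j, hj, h⟩ := hne
    exact h (hα i hi j hj)
  · refine hβ (eq_zero_of_sum_mul_shift_eq_zero hp₁ hp₀ (fun j hj => ?_) hl)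
    rw [← hrel j (by omega)]
    refine Finset.sum_eq_zero fun i hi => ?_
    rw [hα i (Finset.mem_range.1 hi) j (by omega), map_zero, zero_mul]

end Recurrence

section Factor

open Polynomial

theorem exists_factor_X_sub_one {ι A : Type*} [CommRing A] [IsDomain A] {s : Set ι}
    (p : ι → A[X]) {i₁ : ι} (hi₁ : i₁ ∈ s) (hp : p i₁ ≠ 0) :
    ∃ (e : ℕ) (a : ι → A) (b : ι → A[X]),
      (∀ i ∈ s, p i = (X - 1) ^ e * (C (a i) + (X - 1) * b i)) ∧ ∃ i ∈ s, a i ≠ 0 := by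
  have hX : (X - 1 : A[X]) = X - C 1 := by rw [C_1]
  have hnext (i : ι) : ∃ b, p i = C ((p i).eval 1) + (X - 1) * b := by
    obtain ⟨b, hb⟩ := X_sub_C_dvd_sub_C_eval (a := 1) (p := p i)
    exact ⟨b, by rw [hX, ← hb, add_sub_cancel]⟩
  choose b hb using hnext
  by_cases h : ∃ i ∈ s, (p i).eval 1 ≠ 0
  · exact ⟨0, fun i => (p i).eval 1, b, fun i _ => by rw [pow_zero, one_mul]; exact hb i, h⟩
  push Not at h
  have hb' : ∀ i ∈ s, p i = (X - 1) * b i := fun i hi => by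
    rw [hb i, h i hi, map_zero, zero_add]
  have hb₁ : b i₁ ≠ 0 := right_ne_zero_of_mul (hb' i₁ hi₁ ▸ hp)
  have _hdeg : (b i₁).natDegree < (p i₁).natDegree := by
    rw [hb' i₁ hi₁, hX, natDegree_mul (X_sub_C_ne_zero 1) hb₁, natDegree_X_sub_C]
    omega
  obtain ⟨e, a, b', hb'', ha⟩ := exists_factor_X_sub_one b hi₁ hb₁
  exact ⟨e + 1, a, b', fun i hi => by rw [hb' i hi, hb'' i hi, pow_succ', mul_assoc], ha⟩
termination_by (p i₁).natDegree

end Factor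

/-! ### Degrees in `K` of codes -/

/-- The Laurent polynomial in `K` described by a code. -/
noncomputable def laurentVal (l : LaurentCode) :
    LaurentPolynomial (AddMonoidAlgebra ℤ (ℤ × ℤ × ℤ)) :=
  AddMonoidAlgebra.curryRingEquiv l.val

theorem laurentVal_eq_zero_iff {l : LaurentCode} : laurentVal l = 0 ↔ l.val = 0 :=
  map_eq_zero_iff _ AddMonoidAlgebra.curryRingEquiv.injective

/-- The exponents of `K` lie between `-W` and `W`. -/
def HasDegreeLE (W : ℕ) (l : LaurentCode) : Prop := laurentVal l ∈ boundedDegree _ W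

section HasDegreeLE

variable {W W' : ℕ} {l m : LaurentCode}

theorem HasDegreeLE.mono (h : HasDegreeLE W l) (hW : W ≤ W') : HasDegreeLE W' l :=
  boundedDegree_mono hW h

theorem HasDegreeLE.of_zero (h : HasDegreeLE 0 l) : HasDegreeLE W l := h.mono zero_le

theorem hasDegreeLE_zero (W : ℕ) : HasDegreeLE W 0 := by
  simp [HasDegreeLE, laurentVal]

theorem hasDegreeLE_single {d : ℤ} (h : d.natAbs ≤ W) (e : ℤ × ℤ × ℤ) :
    HasDegreeLE W (single (d, e)) := by
  simpa [HasDegreeLE, laurentVal] using single_mem_boundedDegree _ h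

theorem hasDegreeLE_const (c : ℤ) : HasDegreeLE 0 (const c) := by
  rw [HasDegreeLE, laurentVal, val_const, map_intCast, AddMonoidAlgebra.intCast_def]
  exact single_mem_boundedDegree _ le_rfl

theorem hasDegreeLE_one : HasDegreeLE 0 1 := hasDegreeLE_const 1

theorem hasDegreeLE_qCode : HasDegreeLE 0 qCode := hasDegreeLE_single (d := 0) (by simp) _

namespace HasDegreeLE

theorem add (hl : HasDegreeLE W l) (hm : HasDegreeLE W m) : HasDegreeLE W (l + m) := by
  simpa [HasDegreeLE, laurentVal] using add_mem hl hm

theorem sub (hl : HasDegreeLE W l) (hm : HasDegreeLE W m) : HasDegreeLE W (l - m) := by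
  simpa [HasDegreeLE, laurentVal] using sub_mem hl hm

theorem mul (hl : HasDegreeLE W l) (hm : HasDegreeLE W' m) : HasDegreeLE (W + W') (l * m) := by
  simpa [HasDegreeLE, laurentVal] using mul_mem_boundedDegree hl hm

theorem mul_zero (hl : HasDegreeLE W l) (hm : HasDegreeLE 0 m) : HasDegreeLE W (l * m) := by
  simpa only [Nat.add_zero] using hl.mul hm

theorem pow_zero (hl : HasDegreeLE 0 l) (n : ℕ) : HasDegreeLE 0 (l ^ n) := by
  induction n with
  | zero => exact hasDegreeLE_one
  | succ n ih => exact ih.mul_zero hl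

theorem list_prod {ι : Type*} (s : List ι) {d : ι → ℕ} {f : ι → LaurentCode}
    (h : ∀ i ∈ s, HasDegreeLE (d i) (f i)) : HasDegreeLE (s.map d).sum (s.map f).prod := by
  induction s with
  | nil => exact hasDegreeLE_one
  | cons i s ih =>
    rw [List.map_cons, List.map_cons, List.prod_cons, List.sum_cons]
    exact (h i List.mem_cons_self).mul (ih fun j hj => h j (List.mem_cons_of_mem i hj))

theorem horner (hl : HasDegreeLE W l) (s : List LaurentCode) (h : ∀ c ∈ s, HasDegreeLE 0 c) :
    HasDegreeLE (W * s.length) (horner l s) := by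
  induction s with
  | nil => exact hasDegreeLE_zero _
  | cons c s ih =>
    rw [List.length_cons, Nat.mul_succ, add_comm (W * _)]
    exact (h c List.mem_cons_self).of_zero.add
      (hl.mul (ih fun c hc => h c (List.mem_cons_of_mem _ hc)))

theorem fracHorner (hl : HasDegreeLE W l) (s : List (LaurentCode × LaurentCode))
    (h : ∀ c ∈ s, HasDegreeLE 0 c.1 ∧ HasDegreeLE 0 c.2) :
    HasDegreeLE (W * s.length) (fracHorner l s).1 ∧ HasDegreeLE 0 (fracHorner l s).2 := by
  induction s with
  | nil => exact ⟨hasDegreeLE_zero _, hasDegreeLE_one⟩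
  | cons c s ih =>
    obtain ⟨hnum, hden⟩ := ih fun c hc => h c (List.mem_cons_of_mem _ hc)
    obtain ⟨hcnum, hcden⟩ := h c List.mem_cons_self
    rw [List.length_cons, Nat.mul_succ, add_comm (W * _)]
    exact ⟨(hcnum.mul_zero hden).of_zero.add (hl.mul (hnum.mul_zero hcden)), hcden.mul_zero hden⟩

end HasDegreeLE

theorem hasDegreeLE_intCode (s : List ℤ) : HasDegreeLE 0 (intCode qCode s) := by
  have h := hasDegreeLE_qCode.horner (s.map const) fun c hc => by
    obtain ⟨c, -, rfl⟩ := List.mem_map.1 hc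
    exact hasDegreeLE_const c
  rwa [Nat.zero_mul] at h

theorem HasDegreeLE.intCode₂ (hl : HasDegreeLE W l) (s : List (List ℤ)) :
    HasDegreeLE (W * s.length) (intCode₂ qCode l s) := by
  have h := hl.horner (s.map (intCode qCode)) fun c hc => by
    obtain ⟨c, -, rfl⟩ := List.mem_map.1 hc
    exact hasDegreeLE_intCode c
  rwa [List.length_map] at h

end HasDegreeLE

theorem hasDegreeLE_polyCode (p : List (List RatCode)) (i j : ℕ) :
    HasDegreeLE p.length (polyCode p i j).1 := by
  have hQ : HasDegreeLE 0 (single (0, (i : ℤ), 0, 1)) := hasDegreeLE_single (by simp) _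
  have hK : HasDegreeLE 1 (single (1, (j : ℤ), 0, 0)) := hasDegreeLE_single (by simp) _
  have hrow (r : List RatCode) := hQ.fracHorner
    (r.map fun r => (intCode qCode r.num, intCode qCode r.den)) fun c hc => by
      obtain ⟨r, -, rfl⟩ := List.mem_map.1 hc
      exact ⟨hasDegreeLE_intCode _, hasDegreeLE_intCode _⟩
  have h := (hK.fracHorner (p.map _) fun c hc => by
      obtain ⟨r, -, rfl⟩ := List.mem_map.1 hc
      simpa using hrow r).1
  rwa [Nat.one_mul, List.length_map] at h

theorem hasDegreeLE_powCode (r : RatCode) (N i : ℕ) : HasDegreeLE 0 (powCode r N i) :=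
  ((hasDegreeLE_intCode _).pow_zero _).mul_zero ((hasDegreeLE_intCode _).pow_zero _)

theorem hasDegreeLE_quadCode (e : QuadForm) {N i j : ℕ} (hi : i ≤ N) (hj : j ≤ N) :
    HasDegreeLE ((e.nk.natAbs + e.kk.natAbs) * N) (quadCode e i j) := by
  refine hasDegreeLE_single ((Int.natAbs_add_le _ _).trans ?_) _
  rw [Int.natAbs_mul, Int.natAbs_mul, Int.natAbs_natCast, Int.natAbs_natCast, add_mul]
  gcongr

namespace ShiftFactor

variable (f : ShiftFactor)

theorem hasDegreeLE_ratioCode (t : ℤ) : HasDegreeLE f.form.b.natAbs (f.ratioCode t) := by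
  have hb : (f.exponent t).b.natAbs ≤ f.form.b.natAbs := by
    unfold exponent
    cases f.inverse
    · exact le_rfl
    · exact (Int.natAbs_neg _).le
  refine (hasDegreeLE_intCode _).of_zero.sub ?_
  simpa only [Nat.zero_add] using (hasDegreeLE_intCode f.x.num).mul (hasDegreeLE_single hb _)

/-- The growth rate in `N` of the degree of the codes of `f`. -/
def degreeRate : ℕ := 2 * (f.form.a.natAbs + f.form.b.natAbs) * f.form.b.natAbs

theorem hasDegreeLE_code {N i j : ℕ} (hi : i ≤ N) (hj : j ≤ N) :
    HasDegreeLE (f.degreeRate * N) (f.code N i j) := by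
  refine (HasDegreeLE.mul_zero (.list_prod _ fun t _ => f.hasDegreeLE_ratioCode _)
    ((hasDegreeLE_intCode _).pow_zero _)).mono ?_
  rw [List.map_const', List.length_range, List.sum_replicate, smul_eq_mul]
  calc
    _ ≤ 2 * f.range N * f.form.b.natAbs := Nat.mul_le_mul_right _ (f.offset_le hi hj)
    _ = f.degreeRate * N := by
      rw [range, degreeRate]
      ring

end ShiftFactor

theorem exists_hasDegreeLE_shiftCode (T : TermCode) :
    ∃ c, ∀ N i j, i ≤ N → j ≤ N → HasDegreeLE (c * (N + 1)) (T.shiftCode N i j) := by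
  refine ⟨T.poly.length + (T.quad.nk.natAbs + T.quad.kk.natAbs) +
    (T.shiftFactors.map ShiftFactor.degreeRate).sum, fun N i j hi hj => ?_⟩
  have hfactors := HasDegreeLE.list_prod T.shiftFactors fun f _ => f.hasDegreeLE_code hi hj
  rw [List.sum_map_mul_right] at hfactors
  refine (((((hasDegreeLE_polyCode T.poly i j).mul_zero (hasDegreeLE_powCode T.ξ N i)).mul_zero
    (hasDegreeLE_powCode T.η N j)).mul (hasDegreeLE_quadCode T.quad hi hj)).mul hfactors).mono ?_
  simp only [add_mul, mul_add, mul_one]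
  omega

namespace EqCode

variable (P : EqCode)

theorem num_eq_nil {i : ℕ} (hi : P.length ≤ i) : P.num i = [] := by
  rw [num, List.getD_eq_default _ _ hi]
  exact ite_self _

theorem length_num_le_sum (i : ℕ) :
    (P.num i).length ≤ ∑ l ∈ Finset.range P.length, (P.num l).length := by
  obtain hi | hi := lt_or_ge i P.length
  · exact Finset.single_le_sum (f := fun l => (P.num l).length) (fun _ _ => Nat.zero_le _)
      (Finset.mem_range.2 hi)
  · rw [P.num_eq_nil hi]
    exact Nat.zero_le _

theorem exists_hasDegreeLE_coeffCode :
    ∃ g, ∀ x, HasDegreeLE 1 x → ∀ i, HasDegreeLE g (P.coeffCode x i) := by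
  let g := ∑ l ∈ Finset.range P.length, (P.num l).length
  let d l := 1 * (P.den l).length
  refine ⟨g + ((List.range P.length).map d).sum + ((List.range P.length).map d).sum +
    ((List.range P.length).map fun _ => 1).sum, fun x hx i => ?_⟩
  have hnum : HasDegreeLE g (intCode₂ qCode x (P.num i)) :=
    (hx.intCode₂ _).mono (by simpa only [Nat.one_mul] using P.length_num_le_sum i)
  have hden (l : ℕ) : HasDegreeLE (d l) (intCode₂ qCode x (P.den l)) := hx.intCode₂ _
  refine ((hnum.mul (.list_prod _ fun l _ => ?_)).mul (.list_prod _ fun l _ => hden l)).mul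
    (.list_prod _ fun t _ => ?_)
  · split_ifs
    exacts [hasDegreeLE_one.of_zero, hden l]
  · refine hasDegreeLE_one.of_zero.sub ?_
    simpa only [Nat.zero_add] using (hasDegreeLE_qCode.pow_zero (t + 1)).mul hx

end EqCode

theorem coeffEval_eq_zero {R : Type*} [Semiring R] (x : R) {l : List R} (h : ∀ c ∈ l, c = 0) :
    coeffEval x l = 0 := by
  induction l with
  | nil => rfl
  | cons c l ih => simp_all

theorem val_intCode₂_eq_zero {G : Type*} [AddCommMonoid G] {l : List (List ℤ)} (h : AllZero₂ l)
    (x y : GroupRingCode G) : (intCode₂ x y l).val = 0 := by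
  rw [intCode₂, val_horner]
  refine coeffEval_eq_zero _ fun c hc => ?_
  simp only [List.map_map, List.mem_map, Function.comp_apply] at hc
  obtain ⟨m, hm, rfl⟩ := hc
  rw [intCode, val_horner]
  refine coeffEval_eq_zero _ fun c hc => ?_
  simp only [List.map_map, List.mem_map, Function.comp_apply, val_const] at hc
  obtain ⟨a, ha, rfl⟩ := hc
  rw [h m hm a ha, Int.cast_zero]

namespace EqCode

variable {P : EqCode} {i : ℕ}

theorem poly_eq_zero_iff : P.poly i = 0 ↔ poly₂ (P.num i) = 0 := by
  have hden : P.denProd ≠ 0 := Finset.prod_ne_zero_iff.2 fun l _ => P.poly₂_den_ne_zero l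
  have hguard : P.guard ≠ 0 := Finset.prod_ne_zero_iff.2 fun t _ h => by
    simpa using congrArg (Polynomial.eval 0) h
  have hothers : (∏ l ∈ Finset.range P.length, if l = i then 1 else poly₂ (P.den l)) ≠ 0 :=
    Finset.prod_ne_zero_iff.2 fun l _ => by
      split_ifs
      exacts [one_ne_zero, P.poly₂_den_ne_zero l]
  simp [poly, hden, hguard, hothers]

theorem val_coeffCode_eq_zero (h : P.poly i = 0) (x : LaurentCode) :
    (P.coeffCode x i).val = 0 := by
  rw [poly_eq_zero_iff, poly₂_eq_zero_iff] at h
  rw [coeffCode, val_mul, val_mul, val_mul, val_intCode₂_eq_zero h, zero_mul, zero_mul, zero_mul]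

theorem val_coeffCode_ne_zero (h : P.poly i ≠ 0) (l : ℕ) :
    (P.coeffCode (single (1, (l : ℤ), 0, 0)) i).val ≠ 0 := by
  refine fun hval => h (Polynomial.eq_zero_of_infinite_isRoot _ (Set.Infinite.mono ?_
    (Set.infinite_range_of_injective (q_pow_injective.comp (add_left_injective l)))))
  rintro _ ⟨k, rfl⟩
  have heval := ev_coeffCode (κ := RingHom.id Kq) (z := 1) 0 k P l i
  rw [hval, map_zero, RingHom.id_apply] at heval
  exact_mod_cast heval.symm

theorem exists_poly_ne_zero (hP : IsNontrivial P.toEq) : ∃ i < P.length, P.poly i ≠ 0 := by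
  obtain ⟨a, ha, ha₀⟩ := hP
  obtain ⟨i, rfl⟩ := List.get_of_mem ha
  refine ⟨i, P.length_toEq ▸ i.2, fun h => ha₀ ?_⟩
  rw [P.toEq_get i.2, poly_eq_zero_iff.1 h, map_zero, zero_div]

end EqCode

/-! ### Existence of certificates -/

theorem card_equations_lt_card_unknowns {d g m n : ℕ} (hg : g ≤ d)
    (hn : n = (m + 1) * (2 * d + 1) + 2 * g + 1) :
    n * (2 * (d * n - g + g) + 1) < n * n + (n - m) * (2 * (d * n - g) + 1) := by
  have hn₁ : 1 ≤ n := hn ▸ Nat.le_add_left 1 _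
  obtain ⟨W, hW⟩ := Nat.exists_eq_add_of_le (hg.trans (Nat.le_mul_of_pos_right d hn₁))
  obtain ⟨L, hL⟩ := Nat.exists_eq_add_of_le
    (show m ≤ n by have := Nat.le_mul_of_pos_right (m + 1) (by omega : 0 < 2 * d + 1); omega)
  rw [show d * n - g = W by omega, show n - m = L by omega, show W + g = d * n by omega]
  zify at hW hL hn hn₁ ⊢
  rw [show (W : ℤ) = d * n - g by linarith, show (L : ℤ) = n - m by linarith]
  have hsurplus : (n * n + (n - m) * (2 * (d * n - g) + 1) : ℤ) = n * (2 * (d * n) + 1) +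
      (n * (2 * d + 1) + n + m * (2 * g) + m * (n - 1)) := by
    linear_combination (n : ℤ) * hn
  have : (0 : ℤ) ≤ m * (n - 1) := mul_nonneg (by positivity) (by linarith)
  rw [hsurplus]
  have : (0 : ℤ) ≤ n * (2 * d + 1) + m * (2 * g) := by positivity
  linarith

theorem exists_termRelation {P : EqCode} (hP : IsNontrivial P.toEq) (T : TermCode) :
    ∃ (N : ℕ) (α : ℕ → ℕ → AddMonoidAlgebra ℤ (ℤ × ℤ × ℤ))
      (β : ℕ → LaurentPolynomial (AddMonoidAlgebra ℤ (ℤ × ℤ × ℤ))),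
      (∃ i < N + 1, ∃ j < N + 1, α i j ≠ 0) ∧ ∀ j < N + 1,
        ∑ i ∈ Finset.range (N + 1), LaurentPolynomial.C (α i j) * laurentVal (T.shiftCode N i j) =
          ∑ l ∈ Finset.range (N + 2 - P.length), if l ≤ j then
            β l * laurentVal (P.coeffCode (single (1, (l : ℤ), 0, 0)) (j - l)) else 0 := by
  classical
  obtain ⟨c, hc⟩ := exists_hasDegreeLE_shiftCode T
  obtain ⟨g, hg⟩ := P.exists_hasDegreeLE_coeffCode
  have hx (l : ℕ) : HasDegreeLE 1 (single (1, (l : ℤ), 0, 0)) := hasDegreeLE_single (by simp) _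
  have hp (l i : ℕ) : HasDegreeLE g (P.coeffCode (single (1, (l : ℤ), 0, 0)) i) := hg _ (hx l) i
  have hex := EqCode.exists_poly_ne_zero hP
  obtain ⟨hi₀, hpoly⟩ := Nat.find_spec hex
  have hlow : ∀ i < Nat.find hex, P.poly i = 0 := fun i hi => by
    by_contra h
    exact Nat.find_min hex hi ⟨hi.trans hi₀, h⟩
  obtain ⟨m, hm⟩ := Nat.exists_eq_add_of_lt (Nat.zero_lt_of_lt hi₀)
  rw [zero_add] at hm
  let d := c + g
  obtain ⟨N, hN⟩ : ∃ N, N = (m + 1) * (2 * d + 1) + 2 * g := ⟨_, rfl⟩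
  have hgd : g ≤ d := Nat.le_add_left g c
  have hW : d * (N + 1) - g + g = d * (N + 1) :=
    Nat.sub_add_cancel (hgd.trans (Nat.le_mul_of_pos_right d N.succ_pos))
  have hmN : m + 1 ≤ N :=
    hN ▸ (Nat.le_mul_of_pos_right _ (Nat.succ_pos _)).trans (Nat.le_add_right _ _)
  refine ⟨N, exists_recurrence (w := fun i j => laurentVal (T.shiftCode N i j))
    (p := fun l i => laurentVal (P.coeffCode (single (1, (l : ℤ), 0, 0)) i))
    (i₀ := Nat.find hex) (W := d * (N + 1) - g) (g := g)
    (fun i hi j hj => ?_) hp ?_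
    (fun l => laurentVal_eq_zero_iff.not.2 (EqCode.val_coeffCode_ne_zero hpoly l))
    (fun l i hi => laurentVal_eq_zero_iff.2 (EqCode.val_coeffCode_eq_zero (hlow i hi) _)) ?_⟩
  · rw [hW]
    exact (hc N i j (Nat.le_of_lt_succ hi) (Nat.le_of_lt_succ hj)).mono
      (Nat.mul_le_mul_right _ (Nat.le_add_right c g))
  · rw [hm, show N + 2 - (m + 1) = N + 1 - m by omega]
    exact card_equations_lt_card_unknowns hgd (by rw [hN])
  · omega

theorem exists_sum_mul_pow_ne_zero {R : Type*} [CommRing R] [IsDomain R] {t : R}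
    (ht : Function.Injective fun m : ℕ => t ^ m) {n : ℕ} {α : ℕ → R} (hα : ∃ j < n, α j ≠ 0) :
    ∃ w : ℕ, ∑ j ∈ Finset.range n, α j * t ^ (w * j) ≠ 0 := by
  by_contra! hzero
  obtain ⟨j, hj, hαj⟩ := hα
  let p : Polynomial R := ∑ j ∈ Finset.range n, Polynomial.monomial j (α j)
  have hp : p = 0 := by
    refine Polynomial.eq_zero_of_infinite_isRoot _
      (Set.Infinite.mono ?_ (Set.infinite_range_of_injective ht))
    rintro _ ⟨w, rfl⟩
    simpa [p, Polynomial.eval_finsetSum, pow_mul] using hzero w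
  have hcoeff : p.coeff j = α j := by
    simp [p, Polynomial.finsetSum_coeff, Polynomial.coeff_monomial, hj]
  exact hαj (by rw [← hcoeff, hp, Polynomial.coeff_zero])

/-- The map from `ℤ[q][Q][z]` to Laurent polynomials. -/
noncomputable def polyHom :
    Polynomial (Polynomial (Polynomial ℤ)) →+* AddMonoidAlgebra ℤ (ℤ × ℤ × ℤ) :=
  Polynomial.eval₂RingHom (Polynomial.eval₂RingHom (Polynomial.eval₂RingHom (Int.castRingHom _)
    (.single (1, 0, 0) 1)) (.single (0, 0, 1) 1)) (.single (0, 1, 0) 1)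

theorem polyHom_q :
    polyHom (Polynomial.C (Polynomial.C Polynomial.X)) = .single (1, 0, 0) 1 := by
  simp [polyHom]

theorem polyHom_Q : polyHom (Polynomial.C Polynomial.X) = .single (0, 0, 1) 1 := by
  simp [polyHom]

theorem polyHom_z : polyHom Polynomial.X = .single (0, 1, 0) 1 := by
  simp [polyHom]

theorem polyHom_X_sub_one : polyHom (Polynomial.X - 1) = Certificate.zSubOne.val := by
  rw [Certificate.zSubOne, val_sub, val_single, val_one, ← polyHom_z]
  exact (map_sub polyHom _ _).trans (by rw [map_one])

theorem exists_polyHom_eq_single (x : ℤ) (a b c : ℕ) :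
    ∃ p, polyHom p = .single ((a : ℤ), (b : ℤ), (c : ℤ)) x := by
  refine ⟨Polynomial.C (Polynomial.C (Polynomial.C x)) *
    (Polynomial.C (Polynomial.C Polynomial.X) ^ a * Polynomial.X ^ b *
      Polynomial.C Polynomial.X ^ c), ?_⟩
  rw [map_mul, map_mul, map_mul, map_pow, map_pow, map_pow, polyHom_q, polyHom_Q, polyHom_z]
  simp [polyHom, AddMonoidAlgebra.intCast_def, AddMonoidAlgebra.single_pow,
    AddMonoidAlgebra.single_mul_single]

theorem eventually_exists_polyHom_eq (r : AddMonoidAlgebra ℤ (ℤ × ℤ × ℤ)) :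
    ∀ᶠ s : ℕ in Filter.atTop, ∃ p, polyHom p = .single ((s : ℤ), (s : ℤ), (s : ℤ)) 1 * r := by
  induction r using AddMonoidAlgebra.induction_linear with
  | zero => exact .of_forall fun s => ⟨0, by simp⟩
  | add r r' hr hr' =>
    filter_upwards [hr, hr'] with s ⟨p, hp⟩ ⟨p', hp'⟩
    exact ⟨p + p', by rw [map_add, hp, hp', mul_add]⟩
  | single m x =>
    obtain ⟨a, b, c⟩ := m
    filter_upwards [Filter.eventually_ge_atTop (a.natAbs + b.natAbs + c.natAbs)] with s hs
    obtain ⟨p, hp⟩ := exists_polyHom_eq_single x (s + a).toNat (s + b).toNat (s + c).toNat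
    refine ⟨p, hp.trans ?_⟩
    rw [AddMonoidAlgebra.single_mul_single, one_mul, Int.toNat_of_nonneg (by omega),
      Int.toNat_of_nonneg (by omega), Int.toNat_of_nonneg (by omega)]
    rfl

/-- The element of `ℤ[q][Q]` with the given list of coefficients. -/
noncomputable def listPoly₂ (l : List (List ℤ)) : Polynomial (Polynomial ℤ) :=
  coeffEval Polynomial.X ((l.map fun m =>
    coeffEval Polynomial.X (m.map Polynomial.C)).map Polynomial.C)

theorem listPoly₂_surjective : Function.Surjective listPoly₂ := by
  intro p
  obtain ⟨l, rfl⟩ := exists_coeffEval_X_eq p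
  obtain ⟨m, rfl⟩ := List.map_surjective_iff.2 exists_coeffEval_X_eq l
  exact ⟨m, rfl⟩

theorem listPoly₂_eq_zero {l : List (List ℤ)} (h : AllZero₂ l) : listPoly₂ l = 0 := by
  rw [listPoly₂, coeffEval_X_eq_zero_iff]
  simp only [List.mem_map, forall_exists_index, and_imp, forall_apply_eq_imp_iff₂]
  exact fun m hm => (coeffEval_X_eq_zero_iff m).2 (h m hm)

theorem polyHom_listPoly₂ (l : List (List ℤ)) : polyHom (Polynomial.C (listPoly₂ l)) =
    (intCode₂ (single (1, 0, 0)) (single (0, 0, 1)) l).val := by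
  simp only [listPoly₂, intCode₂, intCode, val_horner, map_coeffEval, List.map_map,
    Function.comp_def, polyHom_q, polyHom_Q, val_single, val_const]
  simp

theorem exists_sumRelation {n : ℕ} {α : ℕ → ℕ → AddMonoidAlgebra ℤ (ℤ × ℤ × ℤ)}
    (hα : ∃ i < n, ∃ j < n, α i j ≠ 0) :
    ∃ (w e : ℕ) (u : AddMonoidAlgebra ℤ (ℤ × ℤ × ℤ)) (A : ℕ → List (List ℤ)) (B : ℕ → CoeffCode),
      (∀ i < n, ∑ j ∈ Finset.range n, u * α i j * .single (0, ((w * j : ℕ) : ℤ), 0) 1 =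
        Certificate.zSubOne.val ^ e * ((intCode₂ (single (1, 0, 0)) (single (0, 0, 1)) (A i)).val +
          Certificate.zSubOne.val * (B i).val)) ∧
      ∃ i < n, ¬AllZero₂ (A i) := by
  obtain ⟨i₁, hi₁, hα⟩ := hα
  have hz (m : ℕ) : (AddMonoidAlgebra.single ((0 : ℤ), (1 : ℤ), (0 : ℤ)) (1 : ℤ)) ^ m =
      .single (0, (m : ℤ), 0) 1 := by
    simp [AddMonoidAlgebra.single_pow]
  obtain ⟨w, hw⟩ := exists_sum_mul_pow_ne_zero (t := .single (0, 1, 0) 1) (fun a b hab => by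
    simpa [hz, AddMonoidAlgebra.single_left_inj] using hab) hα
  simp only [hz] at hw
  obtain ⟨s, hs⟩ := ((Filter.eventually_all_finset (Finset.range n)).2 fun i _ =>
    eventually_exists_polyHom_eq
      (∑ j ∈ Finset.range n, α i j * .single (0, ((w * j : ℕ) : ℤ), 0) 1)).exists
  choose! p hp using hs
  have hp₁ : p i₁ ≠ 0 := fun h => by
    have := hp i₁ (Finset.mem_range.2 hi₁)
    rw [h, map_zero, eq_comm, mul_eq_zero] at this
    exact this.elim (by simp) hw
  obtain ⟨e, a, b, hab, i₀, hi₀, ha⟩ := exists_factor_X_sub_one (s := {i | i < n}) p hi₁ hp₁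
  choose A hA using fun i => listPoly₂_surjective (a i)
  choose B hB using fun i => val_surjective (polyHom (b i))
  refine ⟨w, e, .single (s, s, s) 1, A, B, fun i hi => ?_, i₀, hi₀, fun h => ha ?_⟩
  · simp only [mul_assoc]
    rw [← Finset.mul_sum, ← hp i (Finset.mem_range.2 hi), hab i hi, map_mul, map_pow, map_add,
      map_mul, polyHom_X_sub_one, ← hA, polyHom_listPoly₂, hB]
  · rw [← hA, listPoly₂_eq_zero h]

theorem laurentVal_surjective : Function.Surjective laurentVal :=
  (AddMonoidAlgebra.curryRingEquiv ..).surjective.comp val_surjective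

theorem laurentVal_map (r : CoeffCode) :
    laurentVal (r.map fun m => ((0 : ℤ), m)) = LaurentPolynomial.C r.val := by
  refine (congrArg _ (val_map (AddMonoidHom.inr ℤ (ℤ × ℤ × ℤ)) r)).trans ?_
  refine RingHom.congr_fun (f := (AddMonoidAlgebra.curryRingEquiv.toRingHom.comp _))
    (g := LaurentPolynomial.C) (AddMonoidAlgebra.ringHom_ext ?_ ?_) r.val
  · intro c
    rw [← Int.cast_id (n := c), ← AddMonoidAlgebra.intCast_def, map_intCast, map_intCast]
  · rintro ⟨a, b, c⟩
    simp

theorem getD_map_range {α : Type*} (f : ℕ → α) (d : α) {n i : ℕ} (hi : i < n) :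
    ((List.range n).map f).getD i d = f i := by
  simp [List.getD_eq_getElem?_getD, hi]

namespace Certificate

theorem laurentVal_termRelation (P : EqCode) (T : TermCode) (c : Certificate) (j : ℕ) :
    laurentVal (c.termRelation P T j) =
      ∑ i ∈ Finset.range (c.order + 1),
          LaurentPolynomial.C (c.α i j).val * laurentVal (T.shiftCode c.order i j) -
        ∑ l ∈ Finset.range (c.order + 2 - P.length), if l ≤ j then
          laurentVal (c.β l) * laurentVal (P.coeffCode (single (1, (l : ℤ), 0, 0)) (j - l))
        else 0 := by
  have hite (l : ℕ) :
      laurentVal (if l ≤ j then c.β l * P.coeffCode (single (1, (l : ℤ), 0, 0)) (j - l) else 0) =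
        if l ≤ j then
          laurentVal (c.β l) * laurentVal (P.coeffCode (single (1, (l : ℤ), 0, 0)) (j - l))
        else 0 := by
    split_ifs
    · rw [laurentVal, val_mul, map_mul, laurentVal, laurentVal]
    · rw [laurentVal, val_zero, map_zero]
  simp only [← hite, ← laurentVal_map]
  simp only [laurentVal, termRelation, val_sub, val_list_sum, List.map_map, Function.comp_def,
    sum_map_range, map_sub, map_sum, val_mul, map_mul]

theorem val_sumRelation (c : Certificate) (i : ℕ) : (c.sumRelation i).val =
    ∑ j ∈ Finset.range (c.order + 1), (c.α i j).val * .single (0, ((c.weight * j : ℕ) : ℤ), 0) 1 -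
      zSubOne.val ^ c.multiplicity *
        ((intCode₂ (single (1, 0, 0)) (single (0, 0, 1)) (c.A i)).val +
          zSubOne.val * (c.B i).val) := by
  simp only [sumRelation, val_sub, val_list_sum, List.map_map, Function.comp_def, sum_map_range,
    val_mul, val_pow, val_add, val_single]

theorem exists_eq_of_lt (N w e : ℕ) (α : ℕ → ℕ → CoeffCode) (β : ℕ → LaurentCode)
    (A : ℕ → List (List ℤ)) (B : ℕ → CoeffCode) :
    ∃ c : Certificate, c.order = N ∧ c.weight = w ∧ c.multiplicity = e ∧
      (∀ i < N + 2, ∀ j < N + 2, c.α i j = α i j) ∧ (∀ l < N + 2, c.β l = β l) ∧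
      (∀ i < N + 2, c.A i = A i) ∧ ∀ i < N + 2, c.B i = B i :=
  ⟨⟨N, w, e, (List.range (N + 2)).map fun i => (List.range (N + 2)).map (α i),
      (List.range (N + 2)).map β, (List.range (N + 2)).map A, (List.range (N + 2)).map B⟩,
    rfl, rfl, rfl,
    fun i hi j hj => by simp only [Certificate.α, getD_map_range _ _ hi, getD_map_range _ _ hj],
    fun _ hl => getD_map_range _ _ hl, fun _ hi => getD_map_range _ _ hi,
    fun _ hi => getD_map_range _ _ hi⟩

end Certificate

theorem exists_isValid {P : EqCode} (hP : IsNontrivial P.toEq) (T : TermCode) :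
    ∃ c : Certificate, c.IsValid P T := by
  obtain ⟨N, α, β, hα, hterm⟩ := exists_termRelation hP T
  obtain ⟨w, e, u, A, B, hsum, i₀, hi₀, hA⟩ := exists_sumRelation hα
  choose α' hα' using fun i j => val_surjective (u * α i j)
  choose β' hβ' using fun l => laurentVal_surjective (LaurentPolynomial.C u * β l)
  obtain ⟨c, rfl, rfl, rfl, hcα, hcβ, hcA, hcB⟩ := Certificate.exists_eq_of_lt N w e α' β' A B
  refine ⟨c, fun j hj => ?_, fun i hi => ?_, i₀, List.mem_range.2 hi₀, ?_⟩
  · rw [List.mem_range] at hj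
    rw [isZero_iff, ← laurentVal_eq_zero_iff, Certificate.laurentVal_termRelation, sub_eq_zero]
    calc
      _ = LaurentPolynomial.C u * ∑ i ∈ Finset.range (c.order + 1),
            LaurentPolynomial.C (α i j) * laurentVal (T.shiftCode c.order i j) := by
        rw [Finset.mul_sum]
        refine Finset.sum_congr rfl fun i hi => ?_
        rw [hcα i (by have := Finset.mem_range.1 hi; omega) j (by omega), hα', map_mul, mul_assoc]
      _ = _ := by
        rw [hterm j hj, Finset.mul_sum]
        refine Finset.sum_congr rfl fun l hl => ?_
        rw [hcβ l (by have := Finset.mem_range.1 hl; omega), hβ', mul_ite, mul_zero, mul_assoc]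
  · rw [List.mem_range] at hi
    rw [isZero_iff, Certificate.val_sumRelation, sub_eq_zero, hcA i (by omega), hcB i (by omega),
      ← hsum i hi]
    refine Finset.sum_congr rfl fun j hj => ?_
    rw [hcα i (by omega) j (by have := Finset.mem_range.1 hj; omega), hα']
  · rwa [hcA i₀ (by omega)]

/-! ### Every equation has a code -/

section Fractions

variable {R F : Type*} [CommRing R] [Field F]

/-- The map `R[X] → F(X)` induced by a map `R → F`. -/
noncomputable def polyToRatFunc (ι : R →+* F) : Polynomial R →+* RatFunc F :=
  (algebraMap (Polynomial F) (RatFunc F)).comp (Polynomial.mapRingHom ι)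

theorem polyToRatFunc_injective {ι : R →+* F} (hι : Function.Injective ι) :
    Function.Injective (polyToRatFunc ι) :=
  (RatFunc.algebraMap_injective F).comp (Polynomial.map_injective ι hι)

theorem exists_C_mul_eq_map [IsDomain R] {ι : R →+* F} (h : ∀ x, ∃ a b, b ≠ 0 ∧ ι b * x = ι a)
    (p : Polynomial F) :
    ∃ (P : Polynomial R) (b : R), b ≠ 0 ∧ Polynomial.C (ι b) * p = P.map ι := by
  induction p using Polynomial.induction_on' with
  | add p₁ p₂ h₁ h₂ =>
    obtain ⟨P₁, b₁, hb₁, e₁⟩ := h₁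
    obtain ⟨P₂, b₂, hb₂, e₂⟩ := h₂
    refine ⟨Polynomial.C b₂ * P₁ + Polynomial.C b₁ * P₂, b₁ * b₂, mul_ne_zero hb₁ hb₂, ?_⟩
    rw [Polynomial.map_add, Polynomial.map_mul, Polynomial.map_mul, ← e₁, ← e₂,
      Polynomial.map_C, Polynomial.map_C, map_mul, map_mul]
    ring
  | monomial n x =>
    obtain ⟨a, b, hb, e⟩ := h x
    exact ⟨Polynomial.monomial n a, b, hb, by
      rw [Polynomial.C_mul_monomial, e, Polynomial.map_monomial]⟩

theorem exists_polyToRatFunc_mul_eq [IsDomain R] {ι : R →+* F} (hι : Function.Injective ι)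
    (h : ∀ x, ∃ a b, b ≠ 0 ∧ ι b * x = ι a) (x : RatFunc F) :
    ∃ a b, b ≠ 0 ∧ polyToRatFunc ι b * x = polyToRatFunc ι a := by
  obtain ⟨P₁, b₁, hb₁, e₁⟩ := exists_C_mul_eq_map h x.num
  obtain ⟨P₂, b₂, hb₂, e₂⟩ := exists_C_mul_eq_map h x.denom
  have hden : algebraMap (Polynomial F) (RatFunc F) x.denom ≠ 0 :=
    (map_ne_zero_iff _ (RatFunc.algebraMap_injective F)).2 x.denom_ne_zero
  have hι' : ∀ b, b ≠ 0 → Polynomial.C (ι b) ≠ 0 := fun b hb =>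
    Polynomial.C_ne_zero.2 ((map_ne_zero_iff ι hι).2 hb)
  refine ⟨Polynomial.C b₂ * P₁, Polynomial.C b₁ * P₂,
    mul_ne_zero (Polynomial.C_ne_zero.2 hb₁) ?_, ?_⟩
  · rintro rfl
    rw [Polynomial.map_zero] at e₂
    exact mul_ne_zero (hι' b₂ hb₂) x.denom_ne_zero e₂
  · have hx : algebraMap (Polynomial F) (RatFunc F) x.denom * x =
        algebraMap (Polynomial F) (RatFunc F) x.num := by
      rw [mul_comm, ← eq_div_iff hden, RatFunc.num_div_denom]
    simp only [polyToRatFunc, RingHom.comp_apply, Polynomial.coe_mapRingHom, Polynomial.map_C,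
      ← e₁, ← e₂, map_mul]
    linear_combination algebraMap (Polynomial F) (RatFunc F) (Polynomial.C (ι b₁)) *
      algebraMap (Polynomial F) (RatFunc F) (Polynomial.C (ι b₂)) * hx

end Fractions

theorem polyToRatFunc_listPoly₂ (L : List (List ℤ)) :
    polyToRatFunc (polyToRatFunc (Int.castRingHom ℚ)) (listPoly₂ L) = intPoly₂ L := by
  have hX {R F : Type} [CommRing R] [Field F] (ι : R →+* F) :
      polyToRatFunc ι Polynomial.X = RatFunc.X := by simp [polyToRatFunc]
  have hC {R F : Type} [CommRing R] [Field F] (ι : R →+* F) (r : R) :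
      polyToRatFunc ι (Polynomial.C r) = RatFunc.C (ι r) := by simp [polyToRatFunc]
  simp only [listPoly₂, intPoly₂, intPoly_eq_coeffEval, map_coeffEval, List.map_map,
    Function.comp_def, hX, hC]
  simp [q]

theorem exists_ratCode₂_eq (x : KqQ) : ∃ a b, intPoly₂ a / intPoly₂ b = x := by
  have hι : Function.Injective (polyToRatFunc (Int.castRingHom ℚ)) :=
    polyToRatFunc_injective (RingHom.injective_int _)
  obtain ⟨a, b, hb, hab⟩ := exists_polyToRatFunc_mul_eq hι
    (exists_polyToRatFunc_mul_eq (RingHom.injective_int (Int.castRingHom ℚ)) fun x =>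
      ⟨x.num, x.den, by simp, by simp [Rat.den_mul_eq_num]⟩) x
  obtain ⟨a, rfl⟩ := listPoly₂_surjective a
  obtain ⟨b, rfl⟩ := listPoly₂_surjective b
  have hb := (map_ne_zero_iff _ (polyToRatFunc_injective hι)).2 hb
  rw [polyToRatFunc_listPoly₂] at hb hab
  rw [polyToRatFunc_listPoly₂] at hab
  exact ⟨a, b, by rw [div_eq_iff hb, ← hab, mul_comm]⟩

theorem exists_toEq_eq (L : List KqQ) : ∃ P : EqCode, P.toEq = L :=
  List.map_surjective_iff.2
    (fun x => let ⟨a, b, h⟩ := exists_ratCode₂_eq x; ⟨(a, b), h⟩) L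

theorem kernelSum_congr {c c' : ℕ → ℕ → Kq} (h : ∀ n k : ℕ, k ≤ n → c n k = c' n k)
    (J : ℕ → Kq) : kernelSum c J = kernelSum c' J := by
  funext n
  refine Finset.sum_congr rfl fun k hk => ?_
  rw [h n k (Nat.lt_succ_iff.1 (Finset.mem_range.1 hk))]

theorem certSearch_spec {P : EqCode} {T : TermCode} (hP : IsNontrivial P.toEq) (hT : T.IsValid) :
    ∃ A ∈ certSearch (P, T), IsNontrivial (EqCode.toEq A) ∧
      ∀ J : ℕ → Kq, Satisfies J P.toEq → Satisfies (kernelSum T.val J) (EqCode.toEq A) := by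
  obtain ⟨_, hc⟩ := exists_isValid hP T
  obtain ⟨c, hc, hmem⟩ := exists_mem_certSearch hc
  exact ⟨c.output, hmem, hc.isNontrivial_output, fun J hJ => hc.satisfies_output hT hJ⟩

end QHolonomic

open QHolonomic in
theorem theorem5p1 :
    (∀ (c : ℕ → ℕ → Kq) (Jhat : ℕ → Kq),
      IsProperQHypergeometric c → IsQHolonomic Jhat → IsQHolonomic (kernelSum c Jhat)) ∧
    (∃ construct : EqCode × TermCode →. EqCode, Partrec construct ∧
      ∀ (P : EqCode) (T : TermCode), IsNontrivial P.toEq → T.IsValid →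
        ∃ A ∈ construct (P, T), IsNontrivial A.toEq ∧
          ∀ Jhat : ℕ → Kq, Satisfies Jhat P.toEq → Satisfies (kernelSum T.val Jhat) A.toEq) := by
  refine ⟨?_, certSearch, partrec_certSearch, fun P T hP hT => certSearch_spec hP hT⟩
  rintro c J ⟨T, hT, hc⟩ ⟨L, hL, hJ⟩
  obtain ⟨P, rfl⟩ := exists_toEq_eq L
  obtain ⟨A, -, hA, h⟩ := certSearch_spec hL hT
  rw [kernelSum_congr hc]
  exact ⟨A.toEq, hA, h J hJ⟩
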